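/- Let $a<b$, let $m\ge 1$ be an integer, let $k\in L^2((a,b)^2)$ be real-valued, and suppose that the integral operator $(Kx)(s)=\int_a^b k(s,t)x(t)\,dt$ on $L^2(a,b)$ has range contained in the Sobolev space $H^m(a,b)$. Functions in $H^m(a,b)$ are evaluated at points of $[a,b]$ through their continuous representatives, and $\|\cdot\|$ is the norm of $L^2(a,b)$. Let $0<c_1\le c_2$. Then there are constants $C,C'>0$, depending only on $a,b,m,k,c_1,c_2$, such that the following holds. Let $n\ge 1$, let $a\le s_1<\dots<s_n\le b$, and write $|u|_n=\bigl(\frac1n\sum_{i=1}^n u(s_i)^2\bigr)^{1/2}$. Let $\sigma>0$ and let $e_1,\dots,e_n$ be i.i.d. random variables on a probability space with mean zero that are sub-Gaussian with parameter $\sigma$, i.e. $\mathbb E[\exp(\lambda e_i)]\le\exp(\sigma^2\lambda^2/2)$ for all $\lambda\in\mathbb R$. Let $y$ belong to the range of $K$, let $x^\dagger$ be the best-approximate solution of $Kx=y$ (the least-squares solution of minimal norm), let the data be $w_i=y(s_i)+e_i$, and for $\alpha>0$ let $x_{n,\alpha}$ be the minimizer over $x\in L^2(a,b)$ of $\frac1n\sum_{i=1}^n\bigl((Kx)(s_i)-w_i\bigr)^2+\alpha\|x\|^2$.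 Put $\rho_0=\|x^\dagger\|+\sigma n^{-1/2}$ and suppose that $$c_1\,\sigma n^{-1/2}\rho_0^{-1}\le \alpha^{\frac12+\frac1{4m}}\le c_2\,\sigma n^{-1/2}\rho_0^{-1}.$$ Then, for all $z\ge 0$, $$\mathbb P\bigl(|Kx_{n,\alpha}-Kx^\dagger|_n\ge\alpha^{1/2}\rho_0z\bigr)\le 2e^{-Cz^2}\qquad\text{and}\qquad \mathbb P\bigl(\|x_{n,\alpha}\|\ge\rho_0z\bigr)\le 2e^{-Cz^2},$$ and, in the Orlicz norm $\|Z\|_{\psi_2}=\inf\{t>0:\mathbb E[\exp(Z^2/t^2)-1]\le1\}$, $$\bigl\|\,|Kx_{n,\alpha}-Kx^\dagger|_n\,\bigr\|_{\psi_2}\le C'\alpha^{1/2}\rho_0\qquad\text{and}\qquad \bigl\|\,\|x_{n,\alpha}\|\,\bigr\|_{\psi_2}\le C'\rho_0.$$ -/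

import Mathlib

open MeasureTheory ProbabilityTheory
open scoped ENNReal NNReal

noncomputable section

namespace FredholmTikhonov

/-- Lebesgue measure on the interval `(a, b)`. -/
abbrev muI (a b : ℝ) : Measure ℝ := volume.restrict (Set.Ioo a b)

/-- The real Hilbert space `L²(a, b)`. -/
abbrev L2 (a b : ℝ) : Type := Lp ℝ 2 (muI a b)

/-- `g` is the `j`-th weak derivative of `f` on `(a, b)`. -/
def IsWeakDeriv (a b : ℝ) (j : ℕ) (f g : ℝ → ℝ) : Prop :=
  ∀ φ : ℝ → ℝ, ContDiff ℝ (⊤ : ℕ∞) φ → HasCompactSupport φ → tsupport φ ⊆ Set.Ioo a b →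
    ∫ t in Set.Ioo a b, f t * iteratedDeriv j φ t = (-1) ^ j * ∫ t in Set.Ioo a b, g t * φ t

/-- `f` belongs to the Sobolev space `H^m(a, b)`: `f` and its weak derivatives up to order `m`
are in `L²(a, b)`. -/
def MemSobolev (a b : ℝ) (m : ℕ) (f : ℝ → ℝ) : Prop :=
  MemLp f 2 (muI a b) ∧
    ∀ j ≤ m, ∃ g : ℝ → ℝ, MemLp g 2 (muI a b) ∧ IsWeakDeriv a b j f g

/-- The integral operator `(K x)(s) = ∫_a^b k(s, t) x(t) dt` (meaningful for almost every `s`). -/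
def integralOp (a b : ℝ) (k : ℝ × ℝ → ℝ) (x : L2 a b) : ℝ → ℝ :=
  fun s => ∫ t in Set.Ioo a b, k (s, t) * x t

open Classical in
/-- The continuous representative on `[a, b]` of (the class of) `f` (zero if there is none); its
values on `[a, b]` are determined by the class of `f` when `a < b`. -/
def contRep (a b : ℝ) (f : ℝ → ℝ) : ℝ → ℝ :=
  if h : ∃ g : ℝ → ℝ, ContinuousOn g (Set.Icc a b) ∧ g =ᵐ[muI a b] f then h.choose else 0

/-- The point values `f(s₁), …, f(sₙ)`, taken from the continuous representative of `f`. -/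
def sample (a b : ℝ) {n : ℕ} (s : Fin n → ℝ) (f : ℝ → ℝ) : Fin n → ℝ :=
  fun i => contRep a b f (s i)

/-- The empirical semi-norm `|u|_n = (n⁻¹ ∑ uᵢ²)^{1/2}`, as a function of the vector of values. -/
def empNorm {n : ℕ} (u : Fin n → ℝ) : ℝ :=
  √((1 / (n : ℝ)) * ∑ i, u i ^ 2)

/-- `x` minimizes `‖K x - y‖` over `L²(a, b)`. -/
def IsLeastSquaresSolution (a b : ℝ) (k : ℝ × ℝ → ℝ) (y : ℝ → ℝ) (x : L2 a b) : Prop :=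
  ∀ x' : L2 a b,
    eLpNorm (fun s => integralOp a b k x s - y s) 2 (muI a b) ≤
      eLpNorm (fun s => integralOp a b k x' s - y s) 2 (muI a b)

/-- The best-approximate solution of `K x = y`: the least-squares solution of minimal norm. -/
def IsBestApproxSolution (a b : ℝ) (k : ℝ × ℝ → ℝ) (y : ℝ → ℝ) (x : L2 a b) : Prop :=
  IsLeastSquaresSolution a b k y x ∧
    ∀ x' : L2 a b, IsLeastSquaresSolution a b k y x' → ‖x‖ ≤ ‖x'‖

/-- The functional `J(x) = |K x - w|_n² + α ‖x‖²`. -/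
def tikhonov (a b : ℝ) (k : ℝ × ℝ → ℝ) {n : ℕ} (s w : Fin n → ℝ) (α : ℝ) (x : L2 a b) : ℝ :=
  empNorm (sample a b s (integralOp a b k x) - w) ^ 2 + α * ‖x‖ ^ 2

/-- `x` is the regularized solution for the data vector `w` and the parameter `α`. -/
def IsRegularizedSolution (a b : ℝ) (k : ℝ × ℝ → ℝ) {n : ℕ} (s w : Fin n → ℝ) (α : ℝ)
    (x : L2 a b) : Prop :=
  ∀ x' : L2 a b, tikhonov a b k s w α x ≤ tikhonov a b k s w α x'

/-- `‖Z‖_ψ = inf {t > 0 : E[ψ(|Z| / t)] ≤ 1}`, with value `∞` if there is no such `t`. -/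
def orliczNorm {Ω : Type*} [MeasurableSpace Ω] (P : Measure Ω) (ψ : ℝ → ℝ) (Z : Ω → ℝ) : ℝ≥0∞ :=
  ⨅ (t : ℝ) (_ : 0 < t ∧ ∫⁻ ω, ENNReal.ofReal (ψ (t⁻¹ * |Z ω|)) ∂P ≤ 1), ENNReal.ofReal t

/-- The Young function `ψ₂(u) = exp(u²) - 1`. -/
def psiTwo (u : ℝ) : ℝ := Real.exp (u ^ 2) - 1

/-- `e₁, …, eₙ` are i.i.d., centred and sub-Gaussian with parameter `σ`, i.e.
`E[exp(t eᵢ)] ≤ exp(σ² t² / 2)` for all real `t`. -/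
structure IsSubgaussianNoise {Ω : Type*} [MeasurableSpace Ω] (P : Measure Ω) {n : ℕ}
    (e : Fin n → Ω → ℝ) (σ : ℝ) : Prop where
  indep : iIndepFun e P
  identDistrib : ∀ i j, IdentDistrib (e i) (e j) P P
  mean_zero : ∀ i, ∫ ω, e i ω ∂P = 0
  subgaussian : ∀ i, HasSubgaussianMGF (e i) (σ.toNNReal ^ 2) P

end FredholmTikhonov

end

noncomputable section

namespace FredholmTikhonov

section Subgaussian

lemma lintegral_exp_sq_div_four_gaussianReal_le :
    ∫⁻ g, ENNReal.ofReal (Real.exp (g ^ 2 / 4)) ∂(gaussianReal 0 1) ≤ 2 := by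
  rw [gaussianReal_of_var_ne_zero 0 one_ne_zero,
    lintegral_withDensity_eq_lintegral_mul _ (measurable_gaussianPDF 0 1) (by fun_prop)]
  have h1 : ∀ x : ℝ, (gaussianPDF 0 1 * fun g => ENNReal.ofReal (Real.exp (g ^ 2 / 4))) x =
      ENNReal.ofReal ((√(2 * Real.pi))⁻¹ * Real.exp (-(1 / 4) * x ^ 2)) := by
    intro x
    rw [Pi.mul_apply, gaussianPDF, ← ENNReal.ofReal_mul (gaussianPDFReal_nonneg 0 1 x),
      gaussianPDFReal, mul_assoc, ← Real.exp_add]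
    congr 3
    · simp
    · norm_num; ring
  simp_rw [h1]
  rw [← ofReal_integral_eq_lintegral_ofReal
    ((integrable_exp_neg_mul_sq (by norm_num : (0:ℝ) < 1 / 4)).const_mul _)
    (Filter.Eventually.of_forall fun x => by positivity), integral_const_mul, integral_gaussian]
  have : (√(2 * Real.pi))⁻¹ * √(Real.pi / (1 / 4)) ≤ 2 := by
    rw [inv_mul_le_iff₀ (Real.sqrt_pos.2 (by positivity))]
    refine Real.sqrt_le_iff.2 ⟨by positivity, ?_⟩
    rw [mul_pow, Real.sq_sqrt (by positivity)]
    nlinarith [Real.pi_pos]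
  calc _ ≤ ENNReal.ofReal 2 := ENNReal.ofReal_le_ofReal this
    _ = 2 := by simp

variable {Ω : Type*} [MeasurableSpace Ω] {P : Measure Ω} [IsProbabilityMeasure P]

/-- A sub-Gaussian variable with parameter `c` satisfies `E[exp(β X²)] ≤ 2` for `β ≤ 1 / (4 c)`. -/
lemma lintegral_exp_mul_sq_le {X : Ω → ℝ} {c : ℝ≥0} (hX : HasSubgaussianMGF X c P) {β : ℝ}
    (hβ : 0 ≤ β) (hβc : β * c ≤ 1 / 4) :
    ∫⁻ ω, ENNReal.ofReal (Real.exp (β * X ω ^ 2)) ∂P ≤ 2 := by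
  have h1 : ∀ ω, ENNReal.ofReal (Real.exp (β * X ω ^ 2)) =
      ∫⁻ g, ENNReal.ofReal (Real.exp ((√(2 * β) * X ω) * g)) ∂(gaussianReal 0 1) := by
    intro ω
    rw [← ofReal_integral_eq_lintegral_ofReal (integrable_exp_mul_gaussianReal _)
      (Filter.Eventually.of_forall fun x => by positivity)]
    have := mgf_gaussianReal (p := gaussianReal 0 1) (X := id) (μ := 0) (v := 1)
      (by simp) (√(2 * β) * X ω)
    simp only [mgf, id] at this
    rw [this, mul_pow, Real.sq_sqrt (by positivity)]
    congr 2
    simp only [NNReal.coe_one]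
    ring
  simp_rw [h1]
  have hm : AEMeasurable (Function.uncurry fun (ω : Ω) (g : ℝ) =>
      ENNReal.ofReal (Real.exp ((√(2 * β) * X ω) * g))) (P.prod (gaussianReal 0 1)) := by
    have : AEMeasurable (fun p : Ω × ℝ => X p.1) (P.prod (gaussianReal 0 1)) :=
      hX.aemeasurable.comp_fst
    exact ((this.const_mul _).mul measurable_snd.aemeasurable).exp.ennreal_ofReal
  rw [lintegral_lintegral_swap hm]
  refine le_trans (lintegral_mono fun g => ?_) lintegral_exp_sq_div_four_gaussianReal_le
  have h2 := hX.mgf_le (√(2 * β) * g)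
  have h3 := hX.integrable_exp_mul (√(2 * β) * g)
  simp only [mgf] at h2
  have h4 : ∀ ω, (√(2 * β) * X ω) * g = √(2 * β) * g * X ω := fun ω => by ring
  simp_rw [h4]
  rw [← ofReal_integral_eq_lintegral_ofReal h3
      (Filter.Eventually.of_forall fun x => by positivity)]
  refine ENNReal.ofReal_le_ofReal (h2.trans (Real.exp_le_exp.2 ?_))
  rw [mul_pow, Real.sq_sqrt (by positivity)]
  nlinarith [sq_nonneg g]

/-- A quadratic form `∑ⱼ (∑ᵢ Mⱼᵢ eᵢ)²` in independent sub-Gaussian variables is sub-exponential,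
with a constant that depends only on the Hilbert–Schmidt norm of `M`. -/
lemma lintegral_exp_quadratic_le {n r : ℕ} {e : Fin n → Ω → ℝ} {c : ℝ≥0}
    (hind : iIndepFun e P) (hsub : ∀ i, HasSubgaussianMGF (e i) c P)
    (M : Fin r → Fin n → ℝ) {β : ℝ} (hβ : 0 ≤ β)
    (hM : β * (c * ∑ j, ∑ i, M j i ^ 2) ≤ 1 / 4) :
    ∫⁻ ω, ENNReal.ofReal (Real.exp (β * ∑ j, (∑ i, M j i * e i ω) ^ 2)) ∂P ≤ 2 := by
  set w : Fin r → ℝ := fun j => ∑ i, M j i ^ 2 with hw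
  have hw0 : ∀ j, 0 ≤ w j := fun j => Finset.sum_nonneg fun i _ => sq_nonneg _
  set τ : ℝ := ∑ j, w j with hτ
  have hτ0 : 0 ≤ τ := Finset.sum_nonneg fun j _ => hw0 j
  have hrow : ∀ j, w j = 0 → ∀ i, M j i = 0 := fun j hj i => by
    have := (Finset.sum_eq_zero_iff_of_nonneg fun i _ => sq_nonneg (M j i)).1 hj i
      (Finset.mem_univ i)
    exact pow_eq_zero_iff two_ne_zero |>.1 this
  rcases hτ0.eq_or_lt with h0 | hpos
  · have h1 : ∀ j, w j = 0 := fun j =>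
      (Finset.sum_eq_zero_iff_of_nonneg fun j _ => hw0 j).1 h0.symm j (Finset.mem_univ j)
    have h2 : ∀ ω, ∑ j, (∑ i, M j i * e i ω) ^ 2 = 0 := fun ω =>
      Finset.sum_eq_zero fun j _ => by
        simp [hrow j (h1 j)]
    simp [h2]
  · have hX : ∀ j, HasSubgaussianMGF (fun ω => ∑ i, M j i * e i ω)
        (∑ i, ‖M j i‖₊ ^ 2 * c) P := fun j =>
      HasSubgaussianMGF.sum_of_iIndepFun (s := Finset.univ)
        (X := fun i ω => M j i * e i ω)
        (hind.comp (fun i x => M j i * x) fun i => by fun_prop)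
        fun i _ => by
          have h := (hsub i).const_mul (M j i)
          convert h using 2
          exact NNReal.eq (by simp; rfl)
    have hXc : ∀ j, ((∑ i, ‖M j i‖₊ ^ 2 * c : ℝ≥0) : ℝ) = w j * c := fun j => by
      simp [hw, Finset.sum_mul]
    set S : Fin r → Ω → ℝ := fun j ω => ∑ i, M j i * e i ω with hS
    have hj : ∀ j, ∫⁻ ω, ENNReal.ofReal (Real.exp (β * τ / w j * S j ω ^ 2)) ∂P ≤ 2 := fun j =>
      lintegral_exp_mul_sq_le (hX j) (by have := hw0 j; positivity) (by
        rw [hXc]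
        rcases (hw0 j).eq_or_lt with h | h
        · rw [← h]; simp
        · have : β * τ / w j * (w j * c) = β * (c * τ) := by field_simp
          rw [this]; exact hM)
    have hconv : ∀ ω, Real.exp (β * ∑ j, S j ω ^ 2) ≤
        ∑ j, (w j / τ) * Real.exp (β * τ / w j * S j ω ^ 2) := by
      intro ω
      have := convexOn_exp.map_sum_le (t := Finset.univ) (w := fun j => w j / τ)
        (p := fun j => β * τ / w j * S j ω ^ 2) (fun j _ => div_nonneg (hw0 j) hτ0)
        (by rw [← Finset.sum_div, ← hτ, div_self hpos.ne']) (fun _ _ => Set.mem_univ _)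
      simp only [smul_eq_mul] at this
      refine le_trans (le_of_eq ?_) this
      congr 1
      rw [Finset.mul_sum]
      refine Finset.sum_congr rfl fun j _ => ?_
      rcases (hw0 j).eq_or_lt with h | h
      · have : S j ω = 0 := by simp [hS, hrow j h.symm]
        simp [this]
      · field_simp
    have hmeas : ∀ j, AEMeasurable (S j) P := fun j => (hX j).aemeasurable
    calc _ ≤ ∫⁻ ω, ∑ j, ENNReal.ofReal (w j / τ) *
          ENNReal.ofReal (Real.exp (β * τ / w j * S j ω ^ 2)) ∂P := by
          refine lintegral_mono fun ω => ?_
          refine (ENNReal.ofReal_le_ofReal (hconv ω)).trans (le_of_eq ?_)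
          rw [ENNReal.ofReal_sum_of_nonneg fun j _ =>
            mul_nonneg (div_nonneg (hw0 j) hτ0) (Real.exp_pos _).le]
          exact Finset.sum_congr rfl fun j _ =>
            ENNReal.ofReal_mul (div_nonneg (hw0 j) hτ0)
      _ = ∑ j, ENNReal.ofReal (w j / τ) *
          ∫⁻ ω, ENNReal.ofReal (Real.exp (β * τ / w j * S j ω ^ 2)) ∂P := by
          rw [lintegral_finsetSum' _ fun j _ => by have := hmeas j; fun_prop]
          refine Finset.sum_congr rfl fun j _ => ?_
          rw [lintegral_const_mul' _ _ ENNReal.ofReal_ne_top]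
      _ ≤ ∑ j, ENNReal.ofReal (w j / τ) * 2 :=
          Finset.sum_le_sum fun j _ => mul_le_mul_right (hj j) _
      _ = 2 := by
          rw [← Finset.sum_mul, ← ENNReal.ofReal_sum_of_nonneg fun j _ =>
            div_nonneg (hw0 j) hτ0, ← Finset.sum_div, ← hτ, div_self hpos.ne']
          simp

end Subgaussian

section Orlicz

variable {Ω : Type*} [MeasurableSpace Ω] {P : Measure Ω}

/-- If `Z² ≤ U` with `E[exp(U / T²)] ≤ 2`, then `Z` has sub-Gaussian tails. -/
lemma measureReal_le_two_mul_exp {Z U : Ω → ℝ} (hU : AEMeasurable U P) {T : ℝ} (hT : 0 < T)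
    (hZ : ∀ ω, Z ω ^ 2 ≤ U ω)
    (h2 : ∫⁻ ω, ENNReal.ofReal (Real.exp (U ω / T ^ 2)) ∂P ≤ 2) {q : ℝ} (hq : 0 ≤ q) :
    P.real {ω | q ≤ Z ω} ≤ 2 * Real.exp (-(q / T) ^ 2) := by
  set f : Ω → ℝ≥0∞ := fun ω => ENNReal.ofReal (Real.exp (U ω / T ^ 2)) with hf
  have hfm : AEMeasurable f P := by fun_prop
  have h1 : P {ω | q ≤ Z ω} ≤ P {ω | ENNReal.ofReal (Real.exp ((q / T) ^ 2)) ≤ f ω} := by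
    refine measure_mono fun ω hω => ENNReal.ofReal_le_ofReal (Real.exp_le_exp.2 ?_)
    rw [div_pow]
    have : q ^ 2 ≤ U ω := (pow_le_pow_left₀ hq hω 2).trans (hZ ω)
    gcongr
  have h3 := (mul_meas_ge_le_lintegral₀ hfm (ENNReal.ofReal (Real.exp ((q / T) ^ 2)))).trans h2
  have h4 := (mul_le_mul_right h1 (ENNReal.ofReal (Real.exp ((q / T) ^ 2)))).trans h3
  have h5 := ENNReal.toReal_mono (by simp) h4
  rw [ENNReal.toReal_mul, ENNReal.toReal_ofReal (Real.exp_pos _).le] at h5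
  rw [Real.exp_neg, ← div_eq_mul_inv, le_div_iff₀ (Real.exp_pos _), mul_comm]
  simpa [Measure.real] using h5

lemma orliczNorm_psiTwo_le [IsProbabilityMeasure P] {Z U : Ω → ℝ} {T : ℝ} (hT : 0 < T)
    (hZ : ∀ ω, Z ω ^ 2 ≤ U ω)
    (h2 : ∫⁻ ω, ENNReal.ofReal (Real.exp (U ω / T ^ 2)) ∂P ≤ 2) :
    orliczNorm P psiTwo Z ≤ ENNReal.ofReal T := by
  refine iInf₂_le T ⟨hT, ?_⟩
  have h1 : ∀ ω, ENNReal.ofReal (psiTwo (T⁻¹ * |Z ω|)) ≤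
      ENNReal.ofReal (Real.exp (U ω / T ^ 2)) - 1 := by
    intro ω
    rw [← ENNReal.ofReal_one, ← ENNReal.ofReal_sub _ zero_le_one]
    refine ENNReal.ofReal_le_ofReal (sub_le_sub_right (Real.exp_le_exp.2 ?_) 1)
    rw [mul_pow, sq_abs, inv_pow, inv_mul_eq_div]
    gcongr
    exact hZ ω
  refine (lintegral_mono h1).trans ?_
  have h3 : ∀ ω, 1 ≤ ENNReal.ofReal (Real.exp (U ω / T ^ 2)) := fun ω => by
    rw [← ENNReal.ofReal_one]
    refine ENNReal.ofReal_le_ofReal (Real.one_le_exp ?_)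
    have := (sq_nonneg _).trans (hZ ω)
    positivity
  rw [lintegral_sub' aemeasurable_const (by simp) (Filter.Eventually.of_forall h3)]
  simp only [lintegral_const, measure_univ, mul_one]
  refine (tsub_le_tsub_right h2 1).trans (le_of_eq ?_)
  rw [← one_add_one_eq_two, ENNReal.add_sub_cancel_right (by simp)]

/-- `E[exp((A V + B) / T²)] ≤ 2` when `E[exp(β V)] ≤ 2` and `T` is large. -/
lemma lintegral_exp_affine_le [IsProbabilityMeasure P] {V : Ω → ℝ} (hV0 : ∀ ω, 0 ≤ V ω)
    {β A B T : ℝ} (hT : 0 < T)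
    (h2 : ∫⁻ ω, ENNReal.ofReal (Real.exp (β * V ω)) ∂P ≤ 2)
    (hA : 2 * A ≤ β * T ^ 2) (hB : 4 * B ≤ T ^ 2) :
    ∫⁻ ω, ENNReal.ofReal (Real.exp ((A * V ω + B) / T ^ 2)) ∂P ≤ 2 := by
  have hT2 : 0 < T ^ 2 := by positivity
  have hpt : ∀ ω, Real.exp ((A * V ω + B) / T ^ 2) ≤
      Real.exp (1 / 4) * (5 / 14 * Real.exp (β * V ω) + 7 / 10) := by
    intro ω
    have h1 : (A * V ω + B) / T ^ 2 ≤ 1 / 4 + β * V ω / 2 := by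
      rw [div_le_iff₀ hT2]
      nlinarith [mul_le_mul_of_nonneg_right hA (hV0 ω)]
    refine (Real.exp_le_exp.2 h1).trans ?_
    rw [Real.exp_add]
    refine mul_le_mul_of_nonneg_left ?_ (Real.exp_pos _).le
    have h3 : Real.exp (β * V ω) = Real.exp (β * V ω / 2) ^ 2 := by
      rw [← Real.exp_nat_mul]; congr 1; push_cast; ring
    rw [h3]
    nlinarith [sq_nonneg (Real.exp (β * V ω / 2) - 7 / 5)]
  have he : Real.exp (1 / 4) * (5 / 14 * 2 + 7 / 10) ≤ 2 := by
    have h4 : Real.exp (1 / 4) ^ 4 ≤ 2.7182818286 := by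
      rw [← Real.exp_nat_mul]
      have := Real.exp_one_lt_d9.le
      norm_num at this ⊢
      exact this
    have h5 : Real.exp (1 / 4) ≤ 1.3 := by
      by_contra! h
      have := pow_lt_pow_left₀ h (by norm_num) (n := 4) (by norm_num)
      norm_num at this h4
      linarith
    nlinarith
  calc _ ≤ ∫⁻ ω, ENNReal.ofReal (Real.exp (1 / 4) * (5 / 14)) *
        ENNReal.ofReal (Real.exp (β * V ω)) + ENNReal.ofReal (Real.exp (1 / 4) * (7 / 10)) ∂P := by
        refine lintegral_mono fun ω => ?_
        rw [← ENNReal.ofReal_mul (by positivity), ← ENNReal.ofReal_add (by positivity)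
          (by positivity)]
        exact ENNReal.ofReal_le_ofReal ((hpt ω).trans (le_of_eq (by ring)))
    _ ≤ ENNReal.ofReal (Real.exp (1 / 4) * (5 / 14)) * 2 +
        ENNReal.ofReal (Real.exp (1 / 4) * (7 / 10)) := by
        rw [lintegral_add_right' _ aemeasurable_const,
          lintegral_const_mul' _ _ ENNReal.ofReal_ne_top]
        simp only [lintegral_const, measure_univ, mul_one]
        gcongr
    _ = ENNReal.ofReal (Real.exp (1 / 4) * (5 / 14 * 2 + 7 / 10)) := by
        rw [← ENNReal.ofReal_ofNat 2, ← ENNReal.ofReal_mul (by positivity),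
          ← ENNReal.ofReal_add (by positivity) (by positivity)]
        congr 1
        simp only [OfNat.ofNat]
        ring
    _ ≤ 2 := by
        rw [← ENNReal.ofReal_ofNat 2]
        exact ENNReal.ofReal_le_ofReal he

end Orlicz

section Leverage

open Module

/-- Leverage scores of a subspace `V` of `ℝⁿ`. -/
lemma exists_leverage {ι : Type*} [Fintype ι] (V : Submodule ℝ (EuclideanSpace ℝ ι)) :
    ∃ ℓ : ι → ℝ, (∀ i, 0 ≤ ℓ i) ∧ ∑ i, ℓ i = finrank ℝ V ∧
      ∀ v ∈ V, ∀ i, v i ^ 2 ≤ ℓ i * ∑ i', v i' ^ 2 := by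
  set b := stdOrthonormalBasis ℝ V with hb
  refine ⟨fun i => ∑ j, (b j : EuclideanSpace ℝ ι) i ^ 2,
    fun i => Finset.sum_nonneg fun j _ => sq_nonneg _, ?_, ?_⟩
  · rw [Finset.sum_comm]
    have h1 : ∀ j, ∑ i, (b j : EuclideanSpace ℝ ι) i ^ 2 = 1 := fun j => by
      have h : ‖(b j : EuclideanSpace ℝ ι)‖ = 1 := b.norm_eq_one j
      rw [← EuclideanSpace.real_norm_sq_eq, h, one_pow]
    simp [h1]
  · intro v hv i
    have h1 : v i = ∑ j, inner ℝ (b j) (⟨v, hv⟩ : V) * (b j : EuclideanSpace ℝ ι) i := by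
      have h := congrArg (fun z : V => (z : EuclideanSpace ℝ ι) i) (b.sum_repr' ⟨v, hv⟩)
      simp only [Submodule.coe_sum, Submodule.coe_smul, WithLp.ofLp_sum, Finset.sum_apply,
        WithLp.ofLp_smul, Pi.smul_apply, smul_eq_mul] at h
      exact h.symm
    have h2 : ∑ i', v i' ^ 2 = ∑ j, inner ℝ (b j) (⟨v, hv⟩ : V) ^ 2 := by
      rw [← EuclideanSpace.real_norm_sq_eq]
      have := b.sum_sq_norm_inner_right (⟨v, hv⟩ : V)
      simp only [Real.norm_eq_abs, sq_abs] at this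
      rw [this]
      rfl
    rw [h1, h2, mul_comm]
    exact Finset.sum_mul_sq_le_sq_mul_sq _ _ _

/-- Leverage scores of the polynomials of degree less than `m` on each cell of a partition. -/
lemma exists_leverage_cells {n : ℕ} (m : ℕ) (s : Fin n → ℝ) (q : Fin n → ℕ) :
    ∃ ℓ : Fin n → ℝ, (∀ i, 0 ≤ ℓ i) ∧
      (∀ κ, ∑ i with q i = κ, ℓ i ≤ m) ∧
      ∀ (c : Fin m → ℝ) (i : Fin n), (∑ j, c j * s i ^ (j : ℕ)) ^ 2 ≤
        ℓ i * ∑ i' with q i' = q i, (∑ j, c j * s i' ^ (j : ℕ)) ^ 2 := by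
  let T : ℕ → (Fin m → ℝ) →ₗ[ℝ] EuclideanSpace ℝ (Fin n) := fun κ =>
    { toFun := fun c => WithLp.toLp 2 fun i => if q i = κ then ∑ j, c j * s i ^ (j : ℕ) else 0
      map_add' := fun c d => by
        ext i
        by_cases h : q i = κ <;> simp [h, add_mul, Finset.sum_add_distrib]
      map_smul' := fun r c => by
        ext i
        by_cases h : q i = κ <;> simp [h, Finset.mul_sum, mul_assoc] }
  choose ℓ h0 hsum hle using fun κ => exists_leverage (LinearMap.range (T κ))
  refine ⟨fun i => ℓ (q i) i, fun i => h0 _ i, fun κ => ?_, fun c i => ?_⟩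
  · calc ∑ i with q i = κ, ℓ (q i) i = ∑ i with q i = κ, ℓ κ i :=
          Finset.sum_congr rfl fun i hi => by rw [(Finset.mem_filter.1 hi).2]
      _ ≤ ∑ i, ℓ κ i := Finset.sum_le_sum_of_subset_of_nonneg (Finset.filter_subset _ _)
          fun i _ _ => h0 κ i
      _ ≤ m := by
          rw [hsum κ]
          have := LinearMap.finrank_range_le (T κ)
          rw [finrank_fin_fun] at this
          exact_mod_cast this
  · have h := hle (q i) (T (q i) c) (LinearMap.mem_range_self _ c) i
    simp only [T, LinearMap.coe_mk, AddHom.coe_mk, if_true] at h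
    refine h.trans (le_of_eq ?_)
    rw [Finset.sum_filter]
    congr 1
    refine Finset.sum_congr rfl fun i' _ => ?_
    split_ifs <;> simp

lemma empNorm_sq {n : ℕ} (u : Fin n → ℝ) : empNorm u ^ 2 = (1 / (n : ℝ)) * ∑ i, u i ^ 2 :=
  Real.sq_sqrt (mul_nonneg (by positivity) (Finset.sum_nonneg fun _ _ => sq_nonneg _))

/-- Point values of a function that is well approximated by polynomials on each cell are
controlled by its empirical norm. -/
lemma exists_pointwise_bound {n : ℕ} (m N : ℕ) (s : Fin n → ℝ) (q : Fin n → ℕ)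
    (hq : ∀ i, q i < N) {D α : ℝ} (hD : 0 ≤ D) (hα : 0 < α) :
    ∃ L : Fin n → ℝ, (∀ i, 0 ≤ L i) ∧
      ∑ i, L i ≤ n * (4 * m * N + (4 * m + 2) * (D / α)) ∧
      ∀ (u : Fin n → ℝ) (η : ℝ),
        (∀ κ, ∃ c : Fin m → ℝ, ∀ i, q i = κ →
          (u i - ∑ j, c j * s i ^ (j : ℕ)) ^ 2 ≤ D * η ^ 2) →
        ∀ i, u i ^ 2 ≤ L i * (empNorm u ^ 2 + α * η ^ 2) := by
  obtain ⟨ℓ, h0, hsum, hle⟩ := exists_leverage_cells m s q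
  set c : Fin n → ℕ := fun i => Finset.card {i' | q i' = q i} with hc
  have hDα : 0 ≤ D / α := div_nonneg hD hα.le
  refine ⟨fun i => 4 * n * ℓ i + (4 * ℓ i * c i + 2) * (D / α), fun i => ?_, ?_, ?_⟩
  · have := h0 i
    positivity
  · have h1 : ∑ i, ℓ i ≤ N * m := by
      rw [← Finset.sum_fiberwise_of_maps_to (s := Finset.univ) (t := Finset.range N) (g := q)
        fun i _ => Finset.mem_range.2 (hq i)]
      refine (Finset.sum_le_sum fun κ _ => hsum κ).trans ?_
      simp
    have h2 : ∑ i, ℓ i * c i ≤ m * n := by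
      rw [← Finset.sum_fiberwise_of_maps_to (s := Finset.univ) (t := Finset.range N) (g := q)
        fun i _ => Finset.mem_range.2 (hq i)]
      calc _ = ∑ κ ∈ Finset.range N, (∑ i with q i = κ, ℓ i) *
            (Finset.card {i' | q i' = κ} : ℝ) := by
            refine Finset.sum_congr rfl fun κ _ => ?_
            rw [Finset.sum_mul]
            refine Finset.sum_congr rfl fun i hi => ?_
            rw [hc]
            simp only
            rw [(Finset.mem_filter.1 hi).2]
        _ ≤ ∑ κ ∈ Finset.range N, (m : ℝ) * (Finset.card {i' | q i' = κ} : ℝ) :=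
            Finset.sum_le_sum fun κ _ => mul_le_mul_of_nonneg_right (hsum κ) (by positivity)
        _ = m * n := by
            rw [← Finset.mul_sum, ← Nat.cast_sum,
              ← Finset.card_eq_sum_card_fiberwise (s := Finset.univ) fun i _ => by
                simpa using hq i]
            simp
    have h3 : ∑ i, (4 * n * ℓ i + (4 * ℓ i * c i + 2) * (D / α)) =
        4 * n * ∑ i, ℓ i + (4 * ∑ i, ℓ i * c i + 2 * n) * (D / α) := by
      have h : ∀ i, 4 * n * ℓ i + (4 * ℓ i * c i + 2) * (D / α) =
          4 * n * ℓ i + (4 * (D / α)) * (ℓ i * c i) + 2 * (D / α) := fun i => by ring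
      simp_rw [h, Finset.sum_add_distrib, ← Finset.mul_sum]
      simp only [Finset.sum_const, Finset.card_univ, Fintype.card_fin, nsmul_eq_mul]
      ring
    rw [h3]
    have hn : (0 : ℝ) ≤ n := by positivity
    nlinarith [mul_le_mul_of_nonneg_left h1 hn, mul_le_mul_of_nonneg_right h2 hDα]
  · intro u η hu i
    obtain ⟨d, hd⟩ := hu (q i)
    set p : Fin n → ℝ := fun i => ∑ j, d j * s i ^ (j : ℕ) with hp
    have hn : (n : ℝ) ≠ 0 := by
      have := i.pos
      positivity
    have hE : ∑ i, u i ^ 2 = n * empNorm u ^ 2 := by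
      rw [empNorm_sq]; field_simp
    have h1 : ∑ i' with q i' = q i, p i' ^ 2 ≤
        2 * (n * empNorm u ^ 2) + 2 * (c i * (D * η ^ 2)) := by
      calc _ ≤ ∑ i' with q i' = q i, (2 * u i' ^ 2 + 2 * (D * η ^ 2)) := by
            refine Finset.sum_le_sum fun i' hi' => ?_
            have : (u i' - p i') ^ 2 ≤ D * η ^ 2 := hd i' (Finset.mem_filter.1 hi').2
            nlinarith [sq_nonneg (2 * u i' - p i')]
        _ = 2 * ∑ i' with q i' = q i, u i' ^ 2 + 2 * (c i * (D * η ^ 2)) := by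
            rw [Finset.sum_add_distrib, ← Finset.mul_sum, Finset.sum_const, nsmul_eq_mul]
            ring
        _ ≤ 2 * ∑ i', u i' ^ 2 + 2 * (c i * (D * η ^ 2)) := by
            gcongr
            exact Finset.filter_subset _ _
        _ = _ := by rw [hE]
    have h2 := hle d i
    have h3 : (u i - p i) ^ 2 ≤ D * η ^ 2 := hd i rfl
    have h4 : u i ^ 2 ≤ 2 * p i ^ 2 + 2 * (D * η ^ 2) := by
      nlinarith [sq_nonneg (u i - p i - p i)]
    have h5 := mul_le_mul_of_nonneg_left h1 (h0 i)
    have h6 : u i ^ 2 ≤ 4 * n * ℓ i * empNorm u ^ 2 + (4 * ℓ i * c i + 2) * (D * η ^ 2) := by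
      calc _ ≤ 2 * p i ^ 2 + 2 * (D * η ^ 2) := h4
        _ ≤ 2 * (ℓ i * (2 * (n * empNorm u ^ 2) + 2 * (c i * (D * η ^ 2)))) +
            2 * (D * η ^ 2) := by linarith [h2.trans h5]
        _ = _ := by ring
    refine h6.trans ?_
    have h7 : D * η ^ 2 = D / α * (α * η ^ 2) := by field_simp
    have := h0 i
    have h8 : 0 ≤ 4 * n * ℓ i * (α * η ^ 2) := by positivity
    have h9 : 0 ≤ (4 * ℓ i * c i + 2) * (D / α) * empNorm u ^ 2 := by positivity
    calc _ ≤ 4 * n * ℓ i * empNorm u ^ 2 + (4 * ℓ i * c i + 2) * (D / α * (α * η ^ 2)) +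
          4 * n * ℓ i * (α * η ^ 2) + (4 * ℓ i * c i + 2) * (D / α) * empNorm u ^ 2 := by
          rw [h7]; linarith
      _ = _ := by ring

end Leverage

section Dual

/-- The dual norm of a combination of functionals on a subspace of a Hilbert space is the norm of
a matrix acting on the coefficients. -/
lemma exists_matrix_of_functional_bound {F : Type*} [NormedAddCommGroup F]
    [InnerProductSpace ℝ F] [CompleteSpace F] (G : Submodule ℝ F) {n : ℕ} (v : Fin n → F)
    (L : Fin n → ℝ) (hL0 : ∀ i, 0 ≤ L i)
    (hL : ∀ g ∈ G, ∀ i, inner ℝ (v i) g ^ 2 ≤ L i * ‖g‖ ^ 2) :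
    ∃ (r : ℕ) (M : Fin r → Fin n → ℝ), ∑ j, ∑ i, M j i ^ 2 ≤ ∑ i, L i ∧
      ∀ (c : Fin n → ℝ), ∀ g ∈ G,
        (∑ i, c i * inner ℝ (v i) g) ^ 2 ≤ (∑ j, (∑ i, M j i * c i) ^ 2) * ‖g‖ ^ 2 := by
  set K := G.topologicalClosure with hK
  have : CompleteSpace K := G.isClosed_topologicalClosure.completeSpace_coe
  set φ : Fin n → F := fun i => K.starProjection (v i) with hφ
  have hφK : ∀ i, φ i ∈ K := fun i => K.starProjection_apply_mem (v i)
  have hin : ∀ g ∈ K, ∀ i, inner ℝ (v i) g = inner ℝ (φ i) g := fun g hg i => by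
    rw [hφ, ← sub_eq_zero, ← inner_sub_left]
    exact (K.mem_orthogonal' _).1 (K.sub_starProjection_mem_orthogonal (v i)) g hg
  have hLK : ∀ g ∈ K, ∀ i, inner ℝ (v i) g ^ 2 ≤ L i * ‖g‖ ^ 2 := fun g hg i => by
    have hcl : IsClosed {g : F | inner ℝ (v i) g ^ 2 ≤ L i * ‖g‖ ^ 2} :=
      isClosed_le (by fun_prop) (by fun_prop)
    exact closure_minimal (fun g hg => hL g hg i) hcl hg
  have hφL : ∀ i, ‖φ i‖ ^ 2 ≤ L i := fun i => by
    have h1 := hLK (φ i) (hφK i) i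
    rw [hin _ (hφK i) i, real_inner_self_eq_norm_sq] at h1
    rcases (sq_nonneg ‖φ i‖).eq_or_lt with h | h
    · rw [← h]; exact hL0 i
    · rw [sq (‖φ i‖ ^ 2)] at h1
      exact le_of_mul_le_mul_right h1 h
  set S := Submodule.span ℝ (Set.range φ) with hS
  have : FiniteDimensional ℝ S := FiniteDimensional.span_of_finite ℝ (Set.finite_range φ)
  set b := stdOrthonormalBasis ℝ S with hb
  have hφS : ∀ i, φ i ∈ S := fun i => Submodule.subset_span ⟨i, rfl⟩
  have hns : ∀ z ∈ S, ∑ j, inner ℝ (b j : F) z ^ 2 = ‖z‖ ^ 2 := fun z hz => by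
    have := b.sum_sq_norm_inner_right (⟨z, hz⟩ : S)
    simp only [Real.norm_eq_abs, sq_abs] at this
    exact this
  refine ⟨_, fun j i => inner ℝ (b j : F) (φ i), ?_, fun c g hg => ?_⟩
  · rw [Finset.sum_comm]
    exact Finset.sum_le_sum fun i _ => (hns _ (hφS i)).trans_le (hφL i)
  · have hgK : g ∈ K := G.le_topologicalClosure hg
    have h1 : ∑ i, c i * inner ℝ (v i) g = inner ℝ (∑ i, c i • φ i) g := by
      rw [sum_inner]
      refine Finset.sum_congr rfl fun i _ => ?_
      rw [real_inner_smul_left, hin g hgK i]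
    have h2 : ∑ j, (∑ i, inner ℝ (b j : F) (φ i) * c i) ^ 2 = ‖∑ i, c i • φ i‖ ^ 2 := by
      rw [← hns _ (Submodule.sum_mem _ fun i _ => S.smul_mem _ (hφS i))]
      refine Finset.sum_congr rfl fun j _ => ?_
      rw [inner_sum]
      congr 1
      refine Finset.sum_congr rfl fun i _ => ?_
      rw [real_inner_smul_right, mul_comm]
    rw [h1, h2, ← mul_pow]
    exact sq_le_sq' (neg_le_of_abs_le (abs_real_inner_le_norm _ _)) (real_inner_le_norm _ _)

lemma exists_matrix_of_pointwise_bound {H : Type*} [NormedAddCommGroup H]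
    [InnerProductSpace ℝ H] [CompleteSpace H] {n : ℕ} (hn : 1 ≤ n) (A : H →ₗ[ℝ] (Fin n → ℝ))
    {α : ℝ} (hα : 0 < α) (L : Fin n → ℝ) (hL0 : ∀ i, 0 ≤ L i)
    (hL : ∀ h i, A h i ^ 2 ≤ L i * (empNorm (A h) ^ 2 + α * ‖h‖ ^ 2)) :
    ∃ (r : ℕ) (M : Fin r → Fin n → ℝ), ∑ j, ∑ i, M j i ^ 2 ≤ ∑ i, L i ∧
      ∀ (c : Fin n → ℝ) (h : H), (∑ i, c i * A h i) ^ 2 ≤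
        (∑ j, (∑ i, M j i * c i) ^ 2) * (empNorm (A h) ^ 2 + α * ‖h‖ ^ 2) := by
  have hn0 : (0 : ℝ) < n := by positivity
  let T : H →ₗ[ℝ] WithLp 2 (EuclideanSpace ℝ (Fin n) × H) :=
    (WithLp.linearEquiv 2 ℝ (EuclideanSpace ℝ (Fin n) × H)).symm.toLinearMap ∘ₗ
      (((WithLp.linearEquiv 2 ℝ (Fin n → ℝ)).symm.toLinearMap ∘ₗ ((√n)⁻¹ • A)).prod
        (√α • LinearMap.id))
  have hT1 : ∀ h, (T h).fst = WithLp.toLp 2 ((√n)⁻¹ • A h) := fun _ => rfl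
  have hT2 : ∀ h, (T h).snd = √α • h := fun _ => rfl
  have hT : ∀ h, ‖T h‖ ^ 2 = empNorm (A h) ^ 2 + α * ‖h‖ ^ 2 := fun h => by
    rw [WithLp.prod_norm_sq_eq_of_L2, empNorm_sq]
    rw [hT1, hT2, EuclideanSpace.real_norm_sq_eq, norm_smul, mul_pow, Real.norm_eq_abs, sq_abs,
      Real.sq_sqrt hα.le, Finset.mul_sum]
    congr 1
    refine Finset.sum_congr rfl fun i _ => ?_
    simp only [Pi.smul_apply, smul_eq_mul]
    rw [mul_pow, inv_pow, Real.sq_sqrt hn0.le, one_div]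
  let v : Fin n → WithLp 2 (EuclideanSpace ℝ (Fin n) × H) := fun i =>
    WithLp.toLp 2 (EuclideanSpace.single i √n, 0)
  have hv : ∀ h i, inner ℝ (v i) (T h) = A h i := fun h i => by
    rw [WithLp.prod_inner_apply]
    change inner ℝ (EuclideanSpace.single i √n) (T h).fst + inner ℝ (0 : H) (T h).snd = _
    rw [hT1, EuclideanSpace.inner_single_left]
    have : √(n : ℝ) ≠ 0 := (Real.sqrt_pos.2 hn0).ne'
    simp [this]
  obtain ⟨r, M, hM, hle⟩ := exists_matrix_of_functional_bound (LinearMap.range T) v L hL0 (by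
    rintro _ ⟨h, rfl⟩ i
    rw [hv, hT]
    exact hL h i)
  refine ⟨r, M, hM, fun c h => ?_⟩
  have := hle c (T h) (LinearMap.mem_range_self T h)
  simpa only [hv, hT] using this

end Dual

/-- Deterministic stability estimate for the minimizer of a Tikhonov functional. -/
lemma tikhonov_stability {H : Type*} [NormedAddCommGroup H]
    [InnerProductSpace ℝ H] {n : ℕ} (hn : 1 ≤ n) (A : H →ₗ[ℝ] (Fin n → ℝ))
    {α : ℝ} (hα : 0 < α) (c : Fin n → ℝ) {V : ℝ}
    (hV : ∀ h, (∑ i, c i * A h i) ^ 2 ≤ V * (empNorm (A h) ^ 2 + α * ‖h‖ ^ 2)) (hV0 : 0 ≤ V)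
    (x z : H)
    (hmin : empNorm (A x - (A z + c)) ^ 2 + α * ‖x‖ ^ 2 ≤
      empNorm (A z - (A z + c)) ^ 2 + α * ‖z‖ ^ 2) :
    empNorm (A x - A z) ^ 2 + α * ‖x‖ ^ 2 ≤ 8 / (n : ℝ) ^ 2 * V + 3 * α * ‖z‖ ^ 2 := by
  have hn0 : (0 : ℝ) < n := by positivity
  set h := x - z with hh
  have hA : A h = A x - A z := map_sub A x z
  set I : ℝ := (1 / n) * ∑ i, c i * A h i with hI
  have h1 : empNorm (A x - (A z + c)) ^ 2 = empNorm (A h) ^ 2 - 2 * I + empNorm c ^ 2 := by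
    simp only [empNorm_sq, hI, hA]
    rw [show (1 / (n : ℝ)) * ∑ i, (A x - A z) i ^ 2 - 2 * ((1 / n) * ∑ i, c i * (A x - A z) i) +
      1 / n * ∑ i, c i ^ 2 = (1 / n) * (∑ i, (A x - A z) i ^ 2 - 2 * ∑ i, c i * (A x - A z) i +
        ∑ i, c i ^ 2) by ring, Finset.mul_sum _ _ (2 : ℝ), ← Finset.sum_sub_distrib,
        ← Finset.sum_add_distrib]
    congr 1
    refine Finset.sum_congr rfl fun i _ => ?_
    simp only [Pi.sub_apply, Pi.add_apply]
    ring
  have h2 : empNorm (A z - (A z + c)) ^ 2 = empNorm c ^ 2 := by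
    simp [empNorm_sq]
  rw [h1, h2] at hmin
  rw [← hA]
  set Q := empNorm (A h) ^ 2 + α * ‖h‖ ^ 2 with hQ
  have hQ0 : 0 ≤ Q := by positivity
  have h3 : I ^ 2 ≤ V / (n : ℝ) ^ 2 * Q := by
    rw [hI, mul_pow, div_mul_eq_mul_div, one_div, inv_pow, inv_mul_eq_div]
    exact div_le_div_of_nonneg_right (hV h) (by positivity)
  have hW0 : 0 ≤ V / (n : ℝ) ^ 2 := by positivity
  set W := V / (n : ℝ) ^ 2 with hW
  have h4 : 2 * I ≤ 4 * W + Q / 4 := by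
    have h5 : (2 * I) ^ 2 ≤ (4 * W + Q / 4) ^ 2 := by nlinarith [sq_nonneg (4 * W - Q / 4)]
    exact (abs_le_of_sq_le_sq' h5 (by positivity)).2
  have h6 : ‖h‖ ^ 2 ≤ 2 * ‖x‖ ^ 2 + 2 * ‖z‖ ^ 2 := by
    have := norm_sub_le x z
    nlinarith [norm_nonneg h, sq_nonneg (‖x‖ - ‖z‖)]
  have h7 := mul_le_mul_of_nonneg_left h6 hα.le
  have h8 : 8 / (n : ℝ) ^ 2 * V = 8 * W := by rw [hW]; ring
  rw [h8]
  nlinarith [sq_nonneg (empNorm (A h)), mul_nonneg hα.le (sq_nonneg ‖x‖)]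

section CauchySchwarz

lemma sq_integral_mul_le {X : Type*} [MeasurableSpace X] {μ : Measure X} {f g : X → ℝ}
    (hf : MemLp f 2 μ) (hg : MemLp g 2 μ) :
    (∫ x, f x * g x ∂μ) ^ 2 ≤ (∫ x, f x ^ 2 ∂μ) * ∫ x, g x ^ 2 ∂μ := by
  have h1 : ∀ {p q : X → ℝ} (hp : MemLp p 2 μ) (hq : MemLp q 2 μ),
      inner ℝ hp.toLp hq.toLp = ∫ x, p x * q x ∂μ := fun hp hq => by
    rw [L2.inner_def]
    refine integral_congr_ae ?_
    filter_upwards [hp.coeFn_toLp, hq.coeFn_toLp] with x h1 h2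
    rw [h1, h2]
    simp [mul_comm]
  have h2 := real_inner_mul_inner_self_le hf.toLp hg.toLp
  rw [h1, h1, h1] at h2
  simpa only [sq] using h2

end CauchySchwarz

section Primitive

open Function

/-- The primitive of `f` that vanishes at `a`. -/
def primitive (a : ℝ) (f : ℝ → ℝ) : ℝ → ℝ := fun s => ∫ t in a..s, f t

variable {a : ℝ} {f : ℝ → ℝ}

lemma hasDerivAt_primitive (hf : Continuous f) (s : ℝ) : HasDerivAt (primitive a f) (f s) s :=
  intervalIntegral.integral_hasDerivAt_right (hf.intervalIntegrable _ _)
    hf.aestronglyMeasurable.stronglyMeasurableAtFilter hf.continuousAt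

lemma continuous_primitive (hf : Continuous f) : Continuous (primitive a f) :=
  continuous_iff_continuousAt.2 fun s => (hasDerivAt_primitive hf s).continuousAt

lemma deriv_primitive (hf : Continuous f) : deriv (primitive a f) = f :=
  funext fun s => (hasDerivAt_primitive hf s).deriv

lemma contDiff_primitive (hf : ContDiff ℝ (⊤ : ℕ∞) f) :
    ContDiff ℝ (⊤ : ℕ∞) (primitive a f) := by
  rw [contDiff_infty_iff_deriv, deriv_primitive hf.continuous]
  exact ⟨fun s => (hasDerivAt_primitive hf.continuous s).differentiableAt, hf⟩

lemma contDiff_primitive_iterate (hf : ContDiff ℝ (⊤ : ℕ∞) f) (m : ℕ) :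
    ContDiff ℝ (⊤ : ℕ∞) ((primitive a)^[m] f) := by
  induction m with
  | zero => exact hf
  | succ m ih => rw [iterate_succ_apply']; exact contDiff_primitive ih

lemma iteratedDeriv_primitive_iterate (hf : ContDiff ℝ (⊤ : ℕ∞) f) (m : ℕ) :
    iteratedDeriv m ((primitive a)^[m] f) = f := by
  induction m with
  | zero => simp
  | succ m ih =>
    rw [iteratedDeriv_succ', iterate_succ_apply',
      deriv_primitive (contDiff_primitive_iterate hf m).continuous, ih]

/-- Cauchy's formula for repeated integration. -/
lemma primitive_iterate_succ (hf : Continuous f) (k : ℕ) (s : ℝ) :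
    (primitive a)^[k + 1] f s = ∫ t in a..s, (s - t) ^ k / k.factorial * f t := by
  induction k generalizing f with
  | zero => simp [primitive]
  | succ k ih =>
    rw [iterate_succ_apply, ih (continuous_primitive hf)]
    have hu : ∀ t, HasDerivAt (fun t : ℝ => (s - t) ^ (k + 1) / (k + 1).factorial)
        (-((s - t) ^ k / k.factorial)) t := fun t => by
      have h := (((hasDerivAt_id t).const_sub s).pow (k + 1)).div_const ((k + 1).factorial : ℝ)
      have h' : ((k + 1 : ℕ) : ℝ) * (s - id t) ^ (k + 1 - 1) * -1 / (k + 1).factorial =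
          -((s - t) ^ k / k.factorial) := by
        rw [Nat.factorial_succ]
        push_cast
        have : (k.factorial : ℝ) ≠ 0 := by positivity
        have : (k + 1 : ℝ) ≠ 0 := by positivity
        simp only [id]
        field_simp
      rw [h'] at h
      exact h
    rw [intervalIntegral.integral_mul_deriv_eq_deriv_mul (fun t _ => hu t)
      (fun t _ => hasDerivAt_primitive (a := a) hf t)
      (Continuous.intervalIntegrable (by fun_prop) _ _) (hf.intervalIntegrable _ _)]
    simp [primitive]

end Primitive

section Kernel

/-- The truncated power `(t - s)₊ᵏ / k!`. -/
def truncPow (k : ℕ) (s t : ℝ) : ℝ := if s < t then (t - s) ^ k / k.factorial else 0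

lemma measurable_truncPow (k : ℕ) : Measurable fun p : ℝ × ℝ => truncPow k p.1 p.2 :=
  Measurable.ite (measurableSet_lt measurable_fst measurable_snd) (by fun_prop) measurable_const

lemma measurable_truncPow_right (k : ℕ) (s : ℝ) : Measurable (truncPow k s) :=
  (measurable_truncPow k).comp measurable_prodMk_left

lemma abs_truncPow_le (k : ℕ) {s t r : ℝ} (hr : 0 ≤ r) (h : t - s ≤ r) :
    |truncPow k s t| ≤ r ^ k := by
  unfold truncPow
  split_ifs with hst
  · rw [abs_of_nonneg (by have := sub_pos.2 hst; positivity)]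
    refine (div_le_self (pow_nonneg (sub_pos.2 hst).le k) ?_).trans
      (pow_le_pow_left₀ (sub_pos.2 hst).le h k)
    exact_mod_cast Nat.one_le_iff_ne_zero.2 (Nat.factorial_ne_zero k)
  · simpa using pow_nonneg hr k

lemma continuousAt_truncPow (k : ℕ) {s t : ℝ} (h : s ≠ t) :
    ContinuousAt (fun s => truncPow k s t) s := by
  rcases h.lt_or_gt with h | h
  · have : (fun s => truncPow k s t) =ᶠ[nhds s] fun s => (t - s) ^ k / k.factorial := by
      filter_upwards [Iio_mem_nhds h] with r hr
      exact if_pos hr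
    exact (Continuous.continuousAt (by fun_prop)).congr this.symm
  · have : (fun s => truncPow k s t) =ᶠ[nhds s] fun _ => 0 := by
      filter_upwards [Ioi_mem_nhds h] with r hr
      exact if_neg (not_lt.2 (le_of_lt hr))
    exact continuousAt_const.congr this.symm

variable {a b : ℝ}

lemma ae_mem_Ioo (a b : ℝ) : ∀ᵐ t ∂(muI a b), t ∈ Set.Ioo a b :=
  ae_restrict_mem measurableSet_Ioo

instance (a b : ℝ) : IsFiniteMeasure (muI a b) :=
  ⟨by simp [Real.volume_Ioo]⟩

/-- The remainder term `∫_a^b (t - s)₊ᵏ / k! g(t) dt`. -/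
def taylorRem (a b : ℝ) (k : ℕ) (g : ℝ → ℝ) (s : ℝ) : ℝ :=
  ∫ t in Set.Ioo a b, truncPow k s t * g t

lemma integrable_truncPow_mul (k : ℕ) {g : ℝ → ℝ} (hg : Integrable g (muI a b)) {s : ℝ}
    (hs : s ∈ Set.Icc a b) : Integrable (fun t => truncPow k s t * g t) (muI a b) := by
  refine hg.bdd_mul (c := (b - a) ^ k) (measurable_truncPow_right k s).aestronglyMeasurable ?_
  filter_upwards [ae_mem_Ioo a b] with t ht
  exact abs_truncPow_le k (by linarith [ht.1, ht.2]) (by linarith [hs.1, ht.2])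

lemma continuousOn_taylorRem (k : ℕ) {g : ℝ → ℝ} (hg : Integrable g (muI a b)) :
    ContinuousOn (taylorRem a b k g) (Set.Icc a b) := by
  intro s hs
  refine continuousWithinAt_of_dominated (bound := fun t => (b - a) ^ k * |g t|) ?_ ?_
    (hg.abs.const_mul _) ?_
  · filter_upwards [self_mem_nhdsWithin] with r hr
    exact (integrable_truncPow_mul k hg hr).aestronglyMeasurable
  · filter_upwards [self_mem_nhdsWithin] with r hr
    filter_upwards [ae_mem_Ioo a b] with t ht
    rw [Real.norm_eq_abs, abs_mul]
    gcongr
    exact abs_truncPow_le k (by linarith [ht.1, ht.2]) (by linarith [hr.1, ht.2])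
  · have : ∀ᵐ t ∂(muI a b), t ≠ s := by
      refine ae_restrict_of_ae ?_
      simp [ae_iff]
    filter_upwards [this] with t ht
    exact ((continuousAt_truncPow k ht.symm).mul continuousAt_const).continuousWithinAt

/-- Restricted to a subinterval, the remainder is a polynomial up to a small error. -/
lemma exists_polynomial_near_taylorRem (k : ℕ) {g : ℝ → ℝ} (hg : MemLp g 2 (muI a b)) {c d : ℝ}
    (hc : a ≤ c) (hcd : c ≤ d) (hd : d ≤ b) :
    ∃ p : Fin (k + 1) → ℝ, ∀ s ∈ Set.Icc c d,
      (taylorRem a b k g s - ∑ j, p j * s ^ (j : ℕ)) ^ 2 ≤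
        (d - c) ^ (2 * k + 1) * ∫ t in Set.Ioo a b, g t ^ 2 := by
  have hgi : Integrable g (muI a b) := hg.integrable (by norm_num)
  have hmono : ∀ j : ℕ, Integrable (fun t => (Set.Ici d).indicator (fun t => t ^ j * g t) t)
      (muI a b) := fun j => by
    refine Integrable.indicator ?_ measurableSet_Ici
    refine hgi.bdd_mul (c := (max |a| |b|) ^ j) (by fun_prop) ?_
    filter_upwards [ae_mem_Ioo a b] with t ht
    rw [norm_pow]
    refine pow_le_pow_left₀ (norm_nonneg _) ?_ j
    exact abs_le_max_abs_abs ht.1.le ht.2.le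
  refine ⟨fun j => ∫ t in Set.Ioo a b, (Set.Ici d).indicator (fun t => t ^ (k - j) * g t) t *
    ((-1) ^ (j : ℕ) * k.choose j / k.factorial), fun s hs => ?_⟩
  have hsab : s ∈ Set.Icc a b := ⟨hc.trans hs.1, hs.2.trans hd⟩
  have h1 : ∑ j : Fin (k + 1), (∫ t in Set.Ioo a b,
      (Set.Ici d).indicator (fun t => t ^ (k - j) * g t) t *
        ((-1) ^ (j : ℕ) * k.choose j / k.factorial)) * s ^ (j : ℕ) =
      ∫ t in Set.Ioo a b, (Set.Ici d).indicator (fun t => truncPow k s t * g t) t := by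
    simp_rw [← integral_mul_const]
    rw [← integral_finsetSum _ fun j _ => ((hmono _).mul_const _).mul_const _]
    have hne : ∀ᵐ t ∂(muI a b), t ≠ d := by
      refine ae_restrict_of_ae ?_
      simp [ae_iff]
    refine integral_congr_ae ?_
    filter_upwards [hne] with t htd
    by_cases ht : t ∈ Set.Ici d
    · simp only [Set.indicator_of_mem ht]
      have hst : s < t := hs.2.trans_lt (lt_of_le_of_ne ht htd.symm)
      rw [truncPow, if_pos hst, sub_eq_neg_add, add_pow, Finset.sum_range]
      simp only [Finset.sum_div, Finset.sum_mul]
      refine Finset.sum_congr rfl fun j _ => ?_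
      rw [neg_pow]
      ring
    · simp [Set.indicator_of_notMem ht]
  set h : ℝ → ℝ := (Set.Ioo s d).indicator (truncPow k s) with hh
  have h2 : taylorRem a b k g s - ∫ t in Set.Ioo a b,
      (Set.Ici d).indicator (fun t => truncPow k s t * g t) t = ∫ t in Set.Ioo a b, h t * g t := by
    rw [taylorRem, ← integral_sub (integrable_truncPow_mul k hgi hsab)
      ((integrable_truncPow_mul k hgi hsab).indicator measurableSet_Ici)]
    congr 1
    ext t
    by_cases ht : t ∈ Set.Ici d
    · have : t ∉ Set.Ioo s d := fun h => absurd h.2 (not_lt.2 ht)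
      simp [hh, Set.indicator_of_mem ht, Set.indicator_of_notMem this]
    · rw [Set.indicator_of_notMem ht, sub_zero]
      by_cases hst : s < t
      · have : t ∈ Set.Ioo s d := ⟨hst, not_le.1 ht⟩
        rw [hh, Set.indicator_of_mem this]
      · have : t ∉ Set.Ioo s d := fun h => hst h.1
        rw [hh, Set.indicator_of_notMem this, truncPow, if_neg hst]
  have hdc : 0 ≤ d - c := sub_nonneg.2 hcd
  have hb : ∀ t, h t ^ 2 ≤ (Set.Ioo s d).indicator (fun _ => (d - c) ^ (2 * k)) t := fun t => by
    by_cases ht : t ∈ Set.Ioo s d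
    · rw [hh, Set.indicator_of_mem ht, Set.indicator_of_mem ht, ← sq_abs, mul_comm 2 k, pow_mul]
      exact pow_le_pow_left₀ (abs_nonneg _)
        (abs_truncPow_le k hdc (by linarith [ht.2, hs.1])) 2
    · simp [hh, Set.indicator_of_notMem ht]
  have hhm : Measurable h := (measurable_truncPow_right k s).indicator measurableSet_Ioo
  have hhL : MemLp h 2 (muI a b) := by
    refine MemLp.of_bound hhm.aestronglyMeasurable ((d - c) ^ k)
      (Filter.Eventually.of_forall fun t => ?_)
    by_cases ht : t ∈ Set.Ioo s d
    · rw [hh, Set.indicator_of_mem ht]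
      exact abs_truncPow_le k hdc (by linarith [ht.2, hs.1])
    · rw [hh, Set.indicator_of_notMem ht]
      simpa using pow_nonneg hdc k
  have h3 : ∫ t in Set.Ioo a b, h t ^ 2 ≤ (d - c) ^ (2 * k + 1) := by
    calc _ ≤ ∫ t in Set.Ioo a b, (Set.Ioo s d).indicator (fun _ => (d - c) ^ (2 * k)) t :=
          integral_mono hhL.integrable_sq
            ((integrable_const _).indicator measurableSet_Ioo) hb
      _ = (muI a b).real (Set.Ioo s d) * (d - c) ^ (2 * k) := by
          rw [integral_indicator_const _ measurableSet_Ioo, smul_eq_mul]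
      _ ≤ (d - c) * (d - c) ^ (2 * k) := by
          gcongr
          calc (muI a b).real (Set.Ioo s d) ≤ volume.real (Set.Ioo s d) :=
                ENNReal.toReal_mono (by simp) (Measure.restrict_apply_le _ _)
            _ = d - s := by rw [Real.volume_real_Ioo_of_le hs.2]
            _ ≤ d - c := by linarith [hs.1]
      _ = _ := by ring
  rw [h1, h2]
  refine (sq_integral_mul_le hhL hg).trans ?_
  gcongr

end Kernel

section WeakDerivative

open scoped Distributions

variable {a b : ℝ}

lemma exists_Icc_of_tsupport_subset (hab : a < b) {ψ : ℝ → ℝ} (hc : HasCompactSupport ψ)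
    (hs : tsupport ψ ⊆ Set.Ioo a b) :
    ∃ c d, a < c ∧ d < b ∧ Function.support ψ ⊆ Set.Icc c d := by
  rcases (tsupport ψ).eq_empty_or_nonempty with h | h
  · exact ⟨(a + b) / 2, (a + b) / 2, by linarith, by linarith,
      (subset_tsupport ψ).trans (h ▸ Set.empty_subset _)⟩
  · obtain ⟨c, hc1⟩ := IsCompact.exists_isLeast hc h
    obtain ⟨d, hd1⟩ := IsCompact.exists_isGreatest hc h
    exact ⟨c, d, (hs hc1.1).1, (hs hd1.1).2,
      fun x hx => ⟨hc1.2 (subset_tsupport ψ hx), hd1.2 (subset_tsupport ψ hx)⟩⟩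

/-- A smooth compactly supported function with vanishing moments is an iterated derivative of a
smooth compactly supported function. -/
lemma exists_test_primitive (hab : a < b) (k : ℕ) {ψ : ℝ → ℝ} (hψ : ContDiff ℝ (⊤ : ℕ∞) ψ)
    (hc : HasCompactSupport ψ) (hs : tsupport ψ ⊆ Set.Ioo a b)
    (hmom : ∀ j ≤ k, ∫ t in Set.Ioo a b, t ^ j * ψ t = 0) :
    ∃ φ : ℝ → ℝ, ContDiff ℝ (⊤ : ℕ∞) φ ∧ HasCompactSupport φ ∧ tsupport φ ⊆ Set.Ioo a b ∧
      iteratedDeriv (k + 1) φ = ψ ∧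
      ∀ t ∈ Set.Ioo a b, φ t = ∫ s in Set.Ioo a b, truncPow k s t * ψ s := by
  obtain ⟨c, d, hac, hdb, hcd⟩ := exists_Icc_of_tsupport_subset hab hc hs
  have hψc := hψ.continuous
  set φ := (primitive a)^[k + 1] ψ with hφ
  have hform : ∀ t, φ t = ∫ s in a..t, (t - s) ^ k / k.factorial * ψ s :=
    primitive_iterate_succ hψc k
  have hsupp : Function.support φ ⊆ Set.Icc c d := by
    intro t ht
    by_contra hcon
    apply ht
    rw [hform]
    rw [Set.mem_Icc, not_and_or, not_le, not_le] at hcon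
    rcases hcon with h | h
    · rw [intervalIntegral.integral_congr (g := fun _ => (0 : ℝ)), intervalIntegral.integral_zero]
      intro s hs
      have : ψ s = 0 := by
        by_contra h0
        have h1 := (hcd h0).1
        have h2 : s ≤ max a t := hs.2
        exact absurd (h1.trans h2) (not_le.2 (max_lt hac h))
      simp [this]
    · have h1 : (Function.support fun s => (t - s) ^ k / k.factorial * ψ s) ⊆ Set.Icc c d :=
        (Function.support_mul_subset_right _ _).trans hcd
      rw [intervalIntegral.integral_eq_integral_of_support_subset
        (h1.trans fun s hs => ⟨hac.trans_le hs.1, hs.2.trans h.le⟩),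
        ← setIntegral_eq_integral_of_forall_compl_eq_zero (s := Set.Ioo a b) fun s hs => by
          by_contra h0
          have := h1 h0
          exact hs ⟨hac.trans_le this.1, this.2.trans_lt hdb⟩]
      have h2 : ∀ s, (t - s) ^ k / k.factorial * ψ s = ∑ j ∈ Finset.range (k + 1),
          ((-1) ^ j * t ^ (k - j) * k.choose j / k.factorial) * (s ^ j * ψ s) := fun s => by
        rw [sub_eq_neg_add, add_pow, Finset.sum_div, Finset.sum_mul]
        refine Finset.sum_congr rfl fun j _ => ?_
        rw [neg_pow]
        ring
      simp_rw [h2]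
      rw [integral_finsetSum]
      · refine Finset.sum_eq_zero fun j hj => ?_
        rw [integral_const_mul, hmom j (Nat.lt_succ_iff.1 (Finset.mem_range.1 hj)), mul_zero]
      · intro j _
        refine Integrable.const_mul ?_ _
        exact ((Continuous.integrable_of_hasCompactSupport (by fun_prop)
          (hc.mul_left))).integrableOn
  refine ⟨φ, contDiff_primitive_iterate hψ _,
    HasCompactSupport.intro isCompact_Icc fun x hx => by
      by_contra h0
      exact hx (hsupp h0),
    (closure_minimal hsupp isClosed_Icc).trans fun x hx => ⟨hac.trans_le hx.1, hx.2.trans_lt hdb⟩,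
    iteratedDeriv_primitive_iterate hψ _, fun t ht => ?_⟩
  rw [hform, intervalIntegral.integral_of_le ht.1.le, integral_Ioc_eq_integral_Ioo]
  have h3 : ∀ s, truncPow k s t * ψ s =
      (Set.Iio t).indicator (fun s => (t - s) ^ k / k.factorial * ψ s) s := fun s => by
    by_cases h : s < t
    · rw [Set.indicator_of_mem (show s ∈ Set.Iio t from h), truncPow, if_pos h]
    · rw [Set.indicator_of_notMem (show s ∉ Set.Iio t from h), truncPow, if_neg h, zero_mul]
  simp_rw [h3]
  rw [setIntegral_indicator measurableSet_Iio]
  congr 2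
  ext s
  simp only [Set.mem_inter_iff, Set.mem_Ioo, Set.mem_Iio]
  constructor
  · rintro ⟨h1, h2⟩
    exact ⟨⟨h1, h2.trans ht.2⟩, h2⟩
  · rintro ⟨⟨h1, _⟩, h2⟩
    exact ⟨h1, h2⟩

lemma integrable_mul_test {u ψ : ℝ → ℝ} (hu : Integrable u (muI a b)) (hψ : Continuous ψ)
    (hc : HasCompactSupport ψ) : Integrable (fun t => u t * ψ t) (muI a b) := by
  obtain ⟨C, hC⟩ := hψ.bounded_above_of_compact_support hc
  exact hu.mul_bdd hψ.aestronglyMeasurable (Filter.Eventually.of_forall hC)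

/-- The remainder term is dual to the iterated primitive. -/
lemma integral_taylorRem_mul (k : ℕ) {g ψ : ℝ → ℝ} (hg : Integrable g (muI a b))
    (hψ : Integrable ψ (muI a b)) :
    ∫ s in Set.Ioo a b, taylorRem a b k g s * ψ s =
      ∫ t in Set.Ioo a b, g t * ∫ s in Set.Ioo a b, truncPow k s t * ψ s := by
  have hint : Integrable (Function.uncurry fun s t => truncPow k s t * (ψ s * g t))
      ((muI a b).prod (muI a b)) := by
    refine (hψ.mul_prod hg).bdd_mul (c := (b - a) ^ k)
      (measurable_truncPow k).aestronglyMeasurable ?_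
    rw [Measure.prod_restrict]
    filter_upwards [ae_restrict_mem (measurableSet_Ioo.prod measurableSet_Ioo)] with p hp
    exact abs_truncPow_le k (by linarith [hp.1.1, hp.1.2]) (by linarith [hp.1.1, hp.2.2])
  calc _ = ∫ s in Set.Ioo a b, ∫ t in Set.Ioo a b, truncPow k s t * (ψ s * g t) := by
        refine integral_congr_ae (Filter.Eventually.of_forall fun s => ?_)
        simp only [taylorRem]
        rw [← integral_mul_const]
        congr 1
        ext t
        ring
    _ = ∫ t in Set.Ioo a b, ∫ s in Set.Ioo a b, truncPow k s t * (ψ s * g t) :=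
        integral_integral_swap hint
    _ = _ := by
        refine integral_congr_ae (Filter.Eventually.of_forall fun t => ?_)
        simp only
        rw [← integral_const_mul]
        congr 1
        ext s
        ring

lemma ae_eq_zero_of_forall_test {u : ℝ → ℝ} (hu : Integrable u (muI a b))
    (h : ∀ ψ : ℝ → ℝ, ContDiff ℝ (⊤ : ℕ∞) ψ → HasCompactSupport ψ → tsupport ψ ⊆ Set.Ioo a b →
      ∫ t in Set.Ioo a b, u t * ψ t = 0) : u =ᵐ[muI a b] 0 := by
  refine (ae_restrict_iff' measurableSet_Ioo).2 ?_
  refine isOpen_Ioo.ae_eq_zero_of_integral_contDiff_smul_eq_zero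
    (IntegrableOn.locallyIntegrableOn hu) fun ψ h1 h2 h3 => ?_
  rw [← setIntegral_eq_integral_of_forall_compl_eq_zero (s := Set.Ioo a b) fun s hs => by
    rw [image_eq_zero_of_notMem_tsupport fun h => hs (h3 h), zero_smul]]
  rw [← h ψ h1 h2 h3]
  congr 1
  ext t
  rw [smul_eq_mul, mul_comm]

/-- A function with weak derivative `g` of order `k + 1` is a polynomial plus the remainder term
of Taylor's formula. -/
lemma exists_taylor_of_isWeakDeriv (hab : a < b) (k : ℕ) {u g : ℝ → ℝ}
    (hu : Integrable u (muI a b)) (hg : Integrable g (muI a b))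
    (h : IsWeakDeriv a b (k + 1) u g) :
    ∃ p : Fin (k + 1) → ℝ, u =ᵐ[muI a b]
      fun s => ∑ j, p j * s ^ (j : ℕ) + (-1) ^ (k + 1) * taylorRem a b k g s := by
  let U : TopologicalSpace.Opens ℝ := ⟨Set.Ioo a b, isOpen_Ioo⟩
  have hR : Integrable (taylorRem a b k g) (muI a b) :=
    ((continuousOn_taylorRem k hg).integrableOn_Icc).mono_set Set.Ioo_subset_Icc_self
  have hpow : ∀ j : ℕ, Integrable (fun t : ℝ => t ^ j) (muI a b) := fun j =>
    ((continuous_pow j).integrableOn_Icc (a := a) (b := b)).mono_set Set.Ioo_subset_Icc_self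
  set v : ℝ → ℝ := fun s => u s - (-1) ^ (k + 1) * taylorRem a b k g s with hv
  have hvi : Integrable v (muI a b) := hu.sub (hR.const_mul _)
  let pairing : (w : ℝ → ℝ) → Integrable w (muI a b) → (𝓓(U, ℝ) →ₗ[ℝ] ℝ) := fun w hw =>
    { toFun := fun ψ => ∫ t in Set.Ioo a b, w t * ψ t
      map_add' := fun ψ₁ ψ₂ => by
        rw [← integral_add (integrable_mul_test hw ψ₁.continuous ψ₁.hasCompactSupport)
          (integrable_mul_test hw ψ₂.continuous ψ₂.hasCompactSupport)]
        congr 1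
        ext t
        simp [mul_add]
      map_smul' := fun r ψ => by
        rw [RingHom.id_apply, smul_eq_mul, ← integral_const_mul]
        congr 1
        ext t
        simp only [FunLike.coe_smul, Pi.smul_apply, smul_eq_mul]
        ring }
  have hmem : pairing v hvi ∈ Submodule.span ℝ
      (Set.range fun j : Fin (k + 1) => pairing (fun t => t ^ (j : ℕ)) (hpow j)) := by
    refine mem_span_of_iInf_ker_le_ker fun ψ hψ => ?_
    rw [Submodule.mem_iInf] at hψ
    have hmom : ∀ j ≤ k, ∫ t in Set.Ioo a b, t ^ j * ψ t = 0 := fun j hj =>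
      hψ ⟨j, Nat.lt_succ_iff.2 hj⟩
    obtain ⟨φ, h1, h2, h3, h4, h5⟩ := exists_test_primitive hab k ψ.contDiff
      ψ.hasCompactSupport ψ.tsupport_subset hmom
    have h6 := h φ h1 h2 h3
    rw [h4] at h6
    have hψi : Integrable ψ (muI a b) :=
      (ψ.continuous.integrable_of_hasCompactSupport ψ.hasCompactSupport).integrableOn
    have h7 : ∫ t in Set.Ioo a b, taylorRem a b k g t * ψ t = ∫ t in Set.Ioo a b, g t * φ t := by
      rw [integral_taylorRem_mul k hg hψi]
      refine setIntegral_congr_fun measurableSet_Ioo fun t ht => ?_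
      simp only [h5 t ht]
    change ∫ t in Set.Ioo a b, v t * ψ t = 0
    have h8 : ∀ t, v t * ψ t = u t * ψ t - (-1) ^ (k + 1) * (taylorRem a b k g t * ψ t) :=
      fun t => by rw [hv]; ring
    simp_rw [h8]
    rw [integral_sub (integrable_mul_test hu ψ.continuous ψ.hasCompactSupport)
      ((integrable_mul_test hR ψ.continuous ψ.hasCompactSupport).const_mul _),
      integral_const_mul, h7, h6, sub_self]
  obtain ⟨p, hp⟩ := (Submodule.mem_span_range_iff_exists_fun ℝ).1 hmem
  have hpi : ∀ j ∈ Finset.univ, Integrable (fun s : ℝ => p j * s ^ (j : ℕ)) (muI a b) :=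
    fun j _ => (hpow j).const_mul _
  have hzero : (fun s => v s - ∑ j, p j * s ^ (j : ℕ)) =ᵐ[muI a b] 0 := by
    refine ae_eq_zero_of_forall_test (hvi.sub (integrable_finsetSum _ hpi)) fun ψ h1 h2 h3 => ?_
    have h4 := LinearMap.congr_fun hp (⟨ψ, h1, h2, h3⟩ : 𝓓(U, ℝ))
    simp only [LinearMap.sum_apply, LinearMap.smul_apply, smul_eq_mul] at h4
    change ∑ j, p j * ∫ t in Set.Ioo a b, t ^ (j : ℕ) * ψ t = ∫ t in Set.Ioo a b, v t * ψ t at h4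
    simp_rw [sub_mul, Finset.sum_mul]
    rw [integral_sub (integrable_mul_test hvi h1.continuous h2)
      (integrable_finsetSum _ fun j hj => integrable_mul_test (hpi j hj) h1.continuous h2),
      integral_finsetSum _ fun j hj => integrable_mul_test (hpi j hj) h1.continuous h2, ← h4,
      sub_eq_zero]
    refine Finset.sum_congr rfl fun j _ => ?_
    rw [← integral_const_mul]
    congr 1
    ext t
    ring
  refine ⟨p, ?_⟩
  filter_upwards [hzero] with s hs
  simp only [hv, Pi.zero_apply] at hs
  linarith

end WeakDerivative

section ContRep

variable {a b : ℝ}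

lemma eqOn_Icc_of_ae_eq_muI (hab : a < b) {f g : ℝ → ℝ} (hf : ContinuousOn f (Set.Icc a b))
    (hg : ContinuousOn g (Set.Icc a b)) (h : f =ᵐ[muI a b] g) : Set.EqOn f g (Set.Icc a b) := by
  refine Measure.eqOn_Icc_of_ae_eq (μ := volume) hab.ne ?_ hf hg
  rwa [← restrict_Ioo_eq_restrict_Icc]

lemma contRep_spec {f g : ℝ → ℝ} (hg : ContinuousOn g (Set.Icc a b)) (h : g =ᵐ[muI a b] f) :
    ContinuousOn (contRep a b f) (Set.Icc a b) ∧ contRep a b f =ᵐ[muI a b] f := by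
  have hex : ∃ g : ℝ → ℝ, ContinuousOn g (Set.Icc a b) ∧ g =ᵐ[muI a b] f := ⟨g, hg, h⟩
  rw [contRep, dif_pos hex]
  exact hex.choose_spec

lemma contRep_eqOn (hab : a < b) {f g : ℝ → ℝ} (hg : ContinuousOn g (Set.Icc a b))
    (h : g =ᵐ[muI a b] f) : Set.EqOn (contRep a b f) g (Set.Icc a b) :=
  eqOn_Icc_of_ae_eq_muI hab (contRep_spec hg h).1 hg ((contRep_spec hg h).2.trans h.symm)

/-- Functions with a square integrable weak derivative of order `k + 1` have a continuous
representative, which is close to a polynomial on every small interval. -/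
lemma contRep_of_isWeakDeriv (hab : a < b) (k : ℕ) {u g : ℝ → ℝ}
    (hu : MemLp u 2 (muI a b)) (hg : MemLp g 2 (muI a b)) (h : IsWeakDeriv a b (k + 1) u g) :
    (ContinuousOn (contRep a b u) (Set.Icc a b) ∧ contRep a b u =ᵐ[muI a b] u) ∧
      ∀ c d, a ≤ c → c ≤ d → d ≤ b → ∃ p : Fin (k + 1) → ℝ, ∀ s ∈ Set.Icc c d,
        (contRep a b u s - ∑ j, p j * s ^ (j : ℕ)) ^ 2 ≤
          (d - c) ^ (2 * k + 1) * ∫ t in Set.Ioo a b, g t ^ 2 := by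
  have hgi : Integrable g (muI a b) := hg.integrable (by norm_num)
  obtain ⟨p, hp⟩ := exists_taylor_of_isWeakDeriv hab k (hu.integrable (by norm_num)) hgi h
  have hcont : ContinuousOn (fun s => ∑ j, p j * s ^ (j : ℕ) +
      (-1) ^ (k + 1) * taylorRem a b k g s) (Set.Icc a b) :=
    (Continuous.continuousOn (by fun_prop)).add
      (continuousOn_const.mul (continuousOn_taylorRem k hgi))
  refine ⟨contRep_spec hcont hp.symm, fun c d hc hcd hd => ?_⟩
  obtain ⟨q, hq⟩ := exists_polynomial_near_taylorRem k hg hc hcd hd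
  refine ⟨fun j => p j + (-1) ^ (k + 1) * q j, fun s hs => ?_⟩
  rw [contRep_eqOn hab hcont hp.symm ⟨hc.trans hs.1, hs.2.trans hd⟩]
  refine le_trans (le_of_eq ?_) (hq s hs)
  have h1 : ∑ j, (p j + (-1) ^ (k + 1) * q j) * s ^ (j : ℕ) =
      ∑ j, p j * s ^ (j : ℕ) + (-1) ^ (k + 1) * ∑ j, q j * s ^ (j : ℕ) := by
    rw [Finset.mul_sum, ← Finset.sum_add_distrib]
    exact Finset.sum_congr rfl fun j _ => by ring
  have h2 : ((-1 : ℝ) ^ (k + 1)) ^ 2 = 1 := by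
    rw [← pow_mul, mul_comm, pow_mul]; norm_num
  rw [h1, add_sub_add_left_eq_sub, ← mul_sub, mul_pow, h2, one_mul]

end ContRep

section Operator

variable {a b : ℝ}

lemma integral_coe_sq (x : L2 a b) : ∫ t in Set.Ioo a b, x t ^ 2 = ‖x‖ ^ 2 := by
  rw [← real_inner_self_eq_norm_sq, L2.inner_def]
  congr 1
  ext t
  simp [sq]

lemma inner_toLp {f : ℝ → ℝ} (hf : MemLp f 2 (muI a b)) (x : L2 a b) :
    inner ℝ hf.toLp x = ∫ t in Set.Ioo a b, x t * f t := by
  rw [L2.inner_def]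
  refine integral_congr_ae ?_
  filter_upwards [hf.coeFn_toLp] with t ht
  rw [ht]
  simp

lemma ae_memLp_section {k : ℝ × ℝ → ℝ} (hk : MemLp k 2 ((muI a b).prod (muI a b))) :
    ∀ᵐ s ∂(muI a b), MemLp (fun t => k (s, t)) 2 (muI a b) := by
  filter_upwards [hk.integrable_sq.prod_right_ae, hk.aestronglyMeasurable.prodMk_left]
    with s h1 h2
  exact (memLp_two_iff_integrable_sq h2).2 h1

variable {k : ℝ × ℝ → ℝ}

lemma integralOp_add (hk : MemLp k 2 ((muI a b).prod (muI a b))) (x y : L2 a b) :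
    integralOp a b k (x + y) =ᵐ[muI a b] integralOp a b k x + integralOp a b k y := by
  filter_upwards [ae_memLp_section hk] with s hs
  rw [Pi.add_apply]
  simp only [integralOp]
  refine Eq.trans (integral_congr_ae ?_)
    (integral_add (hs.integrable_mul (Lp.memLp x)) (hs.integrable_mul (Lp.memLp y)))
  filter_upwards [Lp.coeFn_add x y] with t ht
  simp only [ht, Pi.add_apply, mul_add]

lemma integralOp_smul (r : ℝ) (x : L2 a b) :
    integralOp a b k (r • x) = r • integralOp a b k x := by
  ext s
  rw [Pi.smul_apply, smul_eq_mul]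
  simp only [integralOp]
  rw [← integral_const_mul]
  refine integral_congr_ae ?_
  filter_upwards [Lp.coeFn_smul r x] with t ht
  rw [ht, Pi.smul_apply, smul_eq_mul]
  ring

lemma integral_integralOp_sq_le (hk : MemLp k 2 ((muI a b).prod (muI a b))) {x : L2 a b}
    (hx : MemLp (integralOp a b k x) 2 (muI a b)) :
    ∫ s in Set.Ioo a b, integralOp a b k x s ^ 2 ≤
      (∫ p, k p ^ 2 ∂((muI a b).prod (muI a b))) * ‖x‖ ^ 2 := by
  rw [integral_prod _ hk.integrable_sq, ← integral_mul_const]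
  refine integral_mono_ae hx.integrable_sq (hk.integrable_sq.integral_prod_left.mul_const _) ?_
  filter_upwards [ae_memLp_section hk] with s hs
  have := sq_integral_mul_le hs (Lp.memLp x)
  rwa [integral_coe_sq] at this

end Operator

section WeakDeriv

variable {a b : ℝ} {j : ℕ} {f f' g g' : ℝ → ℝ}

lemma continuous_iteratedDeriv_test {φ : ℝ → ℝ} (hφ : ContDiff ℝ (⊤ : ℕ∞) φ) (j : ℕ) :
    Continuous (iteratedDeriv j φ) :=
  hφ.continuous_iteratedDeriv j (by exact_mod_cast le_top)

lemma hasCompactSupport_iteratedDeriv {φ : ℝ → ℝ} (hφ : HasCompactSupport φ) (j : ℕ) :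
    HasCompactSupport (iteratedDeriv j φ) := by
  induction j with
  | zero => simpa using hφ
  | succ j ih => rw [iteratedDeriv_succ]; exact ih.deriv

lemma IsWeakDeriv.congr (h : IsWeakDeriv a b j f g) (hf : f =ᵐ[muI a b] f')
    (hg : g =ᵐ[muI a b] g') : IsWeakDeriv a b j f' g' := fun φ h1 h2 h3 => by
  have e1 : ∫ t in Set.Ioo a b, f t * iteratedDeriv j φ t =
      ∫ t in Set.Ioo a b, f' t * iteratedDeriv j φ t :=
    integral_congr_ae (hf.mul (ae_eq_refl (iteratedDeriv j φ)))
  have e2 : ∫ t in Set.Ioo a b, g t * φ t = ∫ t in Set.Ioo a b, g' t * φ t :=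
    integral_congr_ae (hg.mul (ae_eq_refl φ))
  rw [← e1, ← e2]
  exact h φ h1 h2 h3

lemma IsWeakDeriv.add (h : IsWeakDeriv a b j f g) (h' : IsWeakDeriv a b j f' g')
    (hf : Integrable f (muI a b)) (hf' : Integrable f' (muI a b)) (hg : Integrable g (muI a b))
    (hg' : Integrable g' (muI a b)) : IsWeakDeriv a b j (f + f') (g + g') := fun φ h1 h2 h3 => by
  simp only [Pi.add_apply, add_mul]
  have h4 := continuous_iteratedDeriv_test h1 j
  have h5 := hasCompactSupport_iteratedDeriv h2 j
  rw [integral_add (integrable_mul_test hf h4 h5) (integrable_mul_test hf' h4 h5),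
    integral_add (integrable_mul_test hg h1.continuous h2)
      (integrable_mul_test hg' h1.continuous h2), h φ h1 h2 h3, h' φ h1 h2 h3, mul_add]

lemma IsWeakDeriv.smul (h : IsWeakDeriv a b j f g) (r : ℝ) :
    IsWeakDeriv a b j (r • f) (r • g) := fun φ h1 h2 h3 => by
  simp only [Pi.smul_apply, smul_eq_mul, mul_assoc, integral_const_mul]
  rw [h φ h1 h2 h3]
  ring

lemma IsWeakDeriv.unique (h : IsWeakDeriv a b j f g) (h' : IsWeakDeriv a b j f g')
    (hg : Integrable g (muI a b)) (hg' : Integrable g' (muI a b)) : g =ᵐ[muI a b] g' := by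
  have h0 := ae_eq_zero_of_forall_test (hg.sub hg') fun φ h1 h2 h3 => by
    simp only [Pi.sub_apply, sub_mul]
    rw [integral_sub (integrable_mul_test hg h1.continuous h2)
      (integrable_mul_test hg' h1.continuous h2), sub_eq_zero]
    have := (h φ h1 h2 h3).symm.trans (h' φ h1 h2 h3)
    exact mul_left_cancel₀ (pow_ne_zero _ (by norm_num)) this
  filter_upwards [h0] with t ht
  exact sub_eq_zero.1 ht

end WeakDeriv

section ClosedGraph

variable {a b : ℝ} {k : ℝ × ℝ → ℝ} {m : ℕ}

/-- By the closed graph theorem, an integral operator with range in `H^m` is bounded into `H^m`. -/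
lemma exists_weakDeriv_bound (hk : MemLp k 2 ((muI a b).prod (muI a b)))
    (hrange : ∀ x : L2 a b, MemSobolev a b m (integralOp a b k x)) :
    ∃ B : ℝ, ∀ x : L2 a b, ∃ g : ℝ → ℝ, MemLp g 2 (muI a b) ∧
      IsWeakDeriv a b m (integralOp a b k x) g ∧
      ∫ t in Set.Ioo a b, g t ^ 2 ≤ B ^ 2 * ‖x‖ ^ 2 := by
  have hK : ∀ x : L2 a b, MemLp (integralOp a b k x) 2 (muI a b) := fun x => (hrange x).1
  have hi : ∀ {f : ℝ → ℝ}, MemLp f 2 (muI a b) → Integrable f (muI a b) :=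
    fun hf => hf.integrable (by norm_num)
  choose g hg hw using fun x : L2 a b => (hrange x).2 m le_rfl
  have hgD : ∀ x, IsWeakDeriv a b m (integralOp a b k x) (hg x).toLp := fun x =>
    (hw x).congr (ae_eq_refl _) (hg x).coeFn_toLp.symm
  have hiL : ∀ x : L2 a b, Integrable x (muI a b) := fun x => hi (Lp.memLp x)
  let D : L2 a b →ₗ[ℝ] L2 a b :=
    { toFun := fun x => (hg x).toLp
      map_add' := fun x y => by
        refine Lp.ext ((hgD (x + y)).unique ?_ (hiL _) (hiL _))
        exact ((hgD x).add (hgD y) (hi (hK x)) (hi (hK y)) (hiL _) (hiL _)).congr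
          (integralOp_add hk x y).symm (Lp.coeFn_add _ _).symm
      map_smul' := fun r x => by
        refine Lp.ext ((hgD (r • x)).unique ?_ (hiL _) (hiL _))
        rw [integralOp_smul]
        exact ((hgD x).smul r).congr (ae_eq_refl _) (Lp.coeFn_smul r _).symm }
  have hD : ∀ x, IsWeakDeriv a b m (integralOp a b k x) (D x) := hgD
  let T : L2 a b →ₗ[ℝ] L2 a b :=
    { toFun := fun x => (hK x).toLp
      map_add' := fun x y => by
        rw [← MemLp.toLp_add]
        exact MemLp.toLp_congr _ _ (integralOp_add hk x y)
      map_smul' := fun r x => by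
        rw [RingHom.id_apply, ← MemLp.toLp_const_smul]
        exact MemLp.toLp_congr _ _ (by rw [integralOp_smul]) }
  have hTx : ∀ x, T x =ᵐ[muI a b] integralOp a b k x := fun x => (hK x).coeFn_toLp
  have hT : Continuous T := by
    refine AddMonoidHomClass.continuous_of_bound T
      (√(∫ p, k p ^ 2 ∂((muI a b).prod (muI a b)))) fun x => ?_
    refine abs_le_of_sq_le_sq' ?_ (by positivity) |>.2
    rw [mul_pow, Real.sq_sqrt (integral_nonneg fun _ => sq_nonneg _), ← integral_coe_sq (T x)]
    refine le_trans (le_of_eq (integral_congr_ae ?_)) (integral_integralOp_sq_le hk (hK x))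
    filter_upwards [hTx x] with t ht
    rw [ht]
  have hcont : Continuous D := by
    refine D.continuous_of_seq_closed_graph fun u x y hu hDu => ?_
    refine Lp.ext (IsWeakDeriv.unique (f := integralOp a b k x) (j := m) ?_ (hD x) (hiL _) (hiL _))
    intro φ h1 h2 h3
    have hφ : MemLp φ 2 (muI a b) :=
      (h1.continuous.memLp_of_hasCompactSupport h2).restrict _
    have hφm : MemLp (iteratedDeriv m φ) 2 (muI a b) :=
      ((continuous_iteratedDeriv_test h1 m).memLp_of_hasCompactSupport
        (hasCompactSupport_iteratedDeriv h2 m)).restrict _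
    have hl : ∀ z, ∫ t in Set.Ioo a b, integralOp a b k z t * iteratedDeriv m φ t =
        inner ℝ hφm.toLp (T z) := fun z => by
      rw [inner_toLp]
      exact integral_congr_ae ((hTx z).symm.mul (ae_eq_refl (iteratedDeriv m φ)))
    rw [hl, ← inner_toLp hφ]
    have hseq : ∀ i, inner ℝ hφm.toLp (T (u i)) = (-1) ^ m * inner ℝ hφ.toLp (D (u i)) :=
      fun i => by
        rw [← hl, inner_toLp hφ]
        exact hD (u i) φ h1 h2 h3
    have hlim1 : Filter.Tendsto (fun i => inner ℝ hφm.toLp (T (u i))) Filter.atTop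
        (nhds (inner ℝ hφm.toLp (T x))) :=
      tendsto_const_nhds.inner ((hT.tendsto x).comp hu)
    have hlim2 : Filter.Tendsto (fun i => (-1) ^ m * inner ℝ hφ.toLp (D (u i))) Filter.atTop
        (nhds ((-1) ^ m * inner ℝ hφ.toLp y)) :=
      (tendsto_const_nhds.inner hDu).const_mul _
    simp_rw [hseq] at hlim1
    exact tendsto_nhds_unique hlim1 hlim2
  let Dc : L2 a b →L[ℝ] L2 a b := ⟨D, hcont⟩
  refine ⟨‖Dc‖, fun x => ⟨D x, Lp.memLp _, hD x, ?_⟩⟩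
  rw [integral_coe_sq, ← mul_pow]
  exact pow_le_pow_left₀ (norm_nonneg _) (Dc.le_opNorm x) 2

end ClosedGraph

section Sampling

variable {a b : ℝ} {k : ℝ × ℝ → ℝ} {l : ℕ}

lemma contRep_integralOp_spec (hab : a < b)
    (hrange : ∀ x : L2 a b, MemSobolev a b (l + 1) (integralOp a b k x)) (x : L2 a b) :
    ContinuousOn (contRep a b (integralOp a b k x)) (Set.Icc a b) ∧
      contRep a b (integralOp a b k x) =ᵐ[muI a b] integralOp a b k x := by
  obtain ⟨g, hg, hw⟩ := (hrange x).2 (l + 1) le_rfl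
  exact (contRep_of_isWeakDeriv hab l (hrange x).1 hg hw).1

/-- Point evaluations of `K x`, as a linear map in `x`. -/
lemma exists_sampling_linearMap (hab : a < b) (hk : MemLp k 2 ((muI a b).prod (muI a b)))
    (hrange : ∀ x : L2 a b, MemSobolev a b (l + 1) (integralOp a b k x)) {n : ℕ} {s : Fin n → ℝ}
    (hs : ∀ i, s i ∈ Set.Icc a b) :
    ∃ A : L2 a b →ₗ[ℝ] (Fin n → ℝ), ∀ x, A x = sample a b s (integralOp a b k x) := by
  have hspec := contRep_integralOp_spec hab hrange
  refine ⟨{ toFun := fun x => sample a b s (integralOp a b k x), map_add' := ?_, map_smul' := ?_ },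
    fun _ => rfl⟩
  · intro x y
    ext i
    exact contRep_eqOn hab ((hspec x).1.add (hspec y).1)
      (((hspec x).2.add (hspec y).2).trans (integralOp_add hk x y).symm) (hs i)
  · intro r x
    ext i
    refine contRep_eqOn (g := r • contRep a b (integralOp a b k x)) hab
      ((hspec x).1.const_smul r) ?_ (hs i)
    rw [integralOp_smul]
    exact (hspec x).2.const_smul r

/-- Point values of `K x` are controlled by the Tikhonov norm; the sum of the constants is the
effective dimension. -/
lemma exists_leverage_integralOp (hab : a < b)
    (hrange : ∀ x : L2 a b, MemSobolev a b (l + 1) (integralOp a b k x)) {B : ℝ}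
    (hB : ∀ x : L2 a b, ∃ g : ℝ → ℝ, MemLp g 2 (muI a b) ∧
      IsWeakDeriv a b (l + 1) (integralOp a b k x) g ∧
      ∫ t in Set.Ioo a b, g t ^ 2 ≤ B ^ 2 * ‖x‖ ^ 2)
    {n : ℕ} {s : Fin n → ℝ} (hs : ∀ i, s i ∈ Set.Icc a b) {N : ℕ} (hN : 1 ≤ N) {α : ℝ}
    (hα : 0 < α) :
    ∃ L : Fin n → ℝ, (∀ i, 0 ≤ L i) ∧
      ∑ i, L i ≤ n * (4 * (l + 1 : ℕ) * (N + 1 : ℕ) +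
        (4 * (l + 1 : ℕ) + 2) * (((b - a) / N) ^ (2 * l + 1) * B ^ 2 / α)) ∧
      ∀ (x : L2 a b) (i : Fin n), sample a b s (integralOp a b k x) i ^ 2 ≤
        L i * (empNorm (sample a b s (integralOp a b k x)) ^ 2 + α * ‖x‖ ^ 2) := by
  have hN0 : (0 : ℝ) < N := by positivity
  set δ : ℝ := (b - a) / N with hδ
  have hδ0 : 0 < δ := div_pos (sub_pos.2 hab) hN0
  have hNδ : N * δ = b - a := by rw [hδ]; field_simp
  set q : Fin n → ℕ := fun i => ⌊(s i - a) / δ⌋₊ with hq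
  have hpos : ∀ i, 0 ≤ (s i - a) / δ := fun i => div_nonneg (sub_nonneg.2 (hs i).1) hδ0.le
  have hqN : ∀ i, q i < N + 1 := fun i => by
    refine Nat.lt_succ_of_le (Nat.floor_le_of_le ?_)
    rw [div_le_iff₀ hδ0, hNδ]
    linarith [(hs i).2]
  obtain ⟨L, h0, hsum, hle⟩ := exists_pointwise_bound (l + 1) (N + 1) s q hqN
    (D := δ ^ (2 * l + 1) * B ^ 2) (by positivity) hα
  refine ⟨L, h0, hsum, fun x i => hle _ ‖x‖ (fun κ => ?_) i⟩
  by_cases hκ : κ ≤ N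
  · obtain ⟨g, hg, hw, hgB⟩ := hB x
    have hκN : (κ : ℝ) * δ ≤ b - a := by
      rw [← hNδ]
      have : (κ : ℝ) ≤ N := by exact_mod_cast hκ
      gcongr
    have hκ0 : 0 ≤ (κ : ℝ) * δ := by positivity
    obtain ⟨p, hp⟩ := (contRep_of_isWeakDeriv hab l (hrange x).1 hg hw).2 (a + κ * δ)
      (min b (a + κ * δ + δ)) (by linarith) (le_min (by linarith) (by linarith)) (min_le_left _ _)
    refine ⟨p, fun i hi => ?_⟩
    have h1 : (κ : ℝ) * δ ≤ s i - a := by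
      rw [← le_div_iff₀ hδ0, ← hi]
      exact Nat.floor_le (hpos i)
    have h2 : s i - a < (κ + 1) * δ := by
      rw [← div_lt_iff₀ hδ0, ← hi]
      exact Nat.lt_floor_add_one _
    refine (hp (s i) ⟨by linarith, le_min (hs i).2 (by linarith)⟩).trans ?_
    have h3 : min b (a + κ * δ + δ) - (a + κ * δ) ≤ δ := by
      linarith [min_le_right b (a + κ * δ + δ)]
    have h4 : 0 ≤ min b (a + κ * δ + δ) - (a + κ * δ) :=
      sub_nonneg.2 (le_min (by linarith) (by linarith))
    rw [mul_assoc]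
    exact mul_le_mul (pow_le_pow_left₀ h4 h3 _) hgB (integral_nonneg fun _ => sq_nonneg _)
      (by positivity)
  · exact ⟨0, fun i hi => absurd (hi ▸ Nat.lt_succ_iff.1 (hqN i)) hκ⟩

/-- A best-approximate solution for attainable data solves the equation. -/
lemma integralOp_ae_eq_of_isBestApproxSolution
    (hK : ∀ x : L2 a b, MemLp (integralOp a b k x) 2 (muI a b)) {y : ℝ → ℝ}
    (hy : ∃ x : L2 a b, integralOp a b k x =ᵐ[muI a b] y) {z : L2 a b}
    (hz : IsBestApproxSolution a b k y z) : integralOp a b k z =ᵐ[muI a b] y := by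
  obtain ⟨x₀, hx₀⟩ := hy
  have h1 := hz.1 x₀
  have h2 : (fun s => integralOp a b k x₀ s - y s) =ᵐ[muI a b] 0 := by
    filter_upwards [hx₀] with s hs
    simp [hs]
  have h3 : AEStronglyMeasurable (fun s => integralOp a b k z s - y s) (muI a b) :=
    (hK z).aestronglyMeasurable.sub ((hK x₀).aestronglyMeasurable.congr hx₀)
  rw [eLpNorm_congr_ae h2, eLpNorm_zero, nonpos_iff_eq_zero,
    eLpNorm_eq_zero_iff h3 (by norm_num)] at h1
  filter_upwards [h1] with s hs
  exact sub_eq_zero.1 hs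

end Sampling

section Dimension

open Real in
/-- The number of cells can be chosen such that the effective dimension is at most of the order
`α ^ (-1 / (2 m))`. -/
lemma exists_number_of_cells (l : ℕ) {c₂ E : ℝ} (hE : 0 ≤ E) :
    ∃ C₀ : ℝ, 0 < C₀ ∧ ∀ α : ℝ, 0 < α →
      α ^ (1 / 2 + 1 / (4 * ((l + 1 : ℕ) : ℝ))) ≤ c₂ → ∃ N : ℕ, 1 ≤ N ∧
        4 * (l + 1 : ℕ) * (N + 1 : ℕ) +
          (4 * (l + 1 : ℕ) + 2) * (E / N ^ (2 * l + 1) / α) ≤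
            C₀ * α ^ (-(1 / (2 * ((l + 1 : ℕ) : ℝ)))) := by
  set m : ℝ := ((l + 1 : ℕ) : ℝ) with hm
  have hm0 : 0 < m := by positivity
  set p : ℝ := 1 / 2 + 1 / (4 * m) with hp
  have hp0 : 0 < p := by positivity
  set A₁ : ℝ := (max c₂ 0) ^ (1 / (2 * m) / p) with hA
  have hA0 : 0 ≤ A₁ := by positivity
  refine ⟨4 * m * (1 + 2 * A₁) + (4 * m + 2) * E, by positivity, fun α hα hαc => ?_⟩
  set β : ℝ := α ^ (-(1 / (2 * m))) with hβ
  have hβ0 : 0 < β := rpow_pos_of_pos hα _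
  have hAβ : 1 ≤ A₁ * β := by
    have h1 : α ^ (1 / (2 * m)) ≤ A₁ := by
      have h2 : α ^ (1 / (2 * m)) = (α ^ p) ^ (1 / (2 * m) / p) := by
        rw [← rpow_mul hα.le]
        congr 1
        field_simp
      rw [h2]
      exact rpow_le_rpow (by positivity) (hαc.trans (le_max_left _ _)) (by positivity)
    calc (1 : ℝ) = α ^ (1 / (2 * m)) * β := by rw [hβ, ← rpow_add hα]; simp
      _ ≤ A₁ * β := by gcongr
  have hβpow : β ^ (2 * l + 1) * β = α⁻¹ := by
    rw [← pow_succ, hβ, ← rpow_natCast, ← rpow_mul hα.le, ← rpow_neg_one]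
    congr 1
    rw [hm]
    push_cast
    have : (l + 1 : ℝ) ≠ 0 := by positivity
    field_simp
    ring
  set N := ⌈β⌉₊ with hN
  have hN1 : 1 ≤ N := Nat.one_le_iff_ne_zero.2 (Nat.ceil_pos.2 hβ0).ne'
  have hβN : β ≤ N := Nat.le_ceil β
  have hNβ : (N : ℝ) < β + 1 := Nat.ceil_lt_add_one hβ0.le
  refine ⟨N, hN1, ?_⟩
  have h1 : ((N + 1 : ℕ) : ℝ) ≤ (1 + 2 * A₁) * β := by
    push_cast
    linarith
  have h2 : E / N ^ (2 * l + 1) / α ≤ E * β := by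
    calc _ ≤ E / β ^ (2 * l + 1) / α := by gcongr
      _ = E * β := by
        have : β ^ (2 * l + 1) ≠ 0 := by positivity
        rw [div_eq_mul_inv _ α, ← hβpow]
        field_simp
  calc _ ≤ 4 * m * ((1 + 2 * A₁) * β) + (4 * m + 2) * (E * β) := by gcongr
    _ = _ := by ring

end Dimension

end FredholmTikhonov

end

open FredholmTikhonov in
theorem mainTheorem2
    (a b : ℝ) (hab : a < b) (m : ℕ) (hm : 1 ≤ m)
    (k : ℝ × ℝ → ℝ)
    (hk : MemLp k 2 ((FredholmTikhonov.muI a b).prod (FredholmTikhonov.muI a b)))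
    (hrange : ∀ x : FredholmTikhonov.L2 a b,
      FredholmTikhonov.MemSobolev a b m (FredholmTikhonov.integralOp a b k x))
    (c₁ c₂ : ℝ) (hc₁ : 0 < c₁) (hc₂ : c₁ ≤ c₂) :
    ∃ C : ℝ, 0 < C ∧ ∃ C' : ℝ, 0 < C' ∧
      ∀ {Ω : Type*} [MeasurableSpace Ω] (P : Measure Ω) [IsProbabilityMeasure P]
        (n : ℕ) (_ : 1 ≤ n) (s : Fin n → ℝ) (_ : StrictMono s) (_ : ∀ i, s i ∈ Set.Icc a b)
        (σ : ℝ) (_ : 0 < σ)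
        (e : Fin n → Ω → ℝ) (_ : FredholmTikhonov.IsSubgaussianNoise P e σ)
        (y : ℝ → ℝ)
        (_ : ∃ x : FredholmTikhonov.L2 a b,
          FredholmTikhonov.integralOp a b k x =ᵐ[FredholmTikhonov.muI a b] y)
        (xdag : FredholmTikhonov.L2 a b)
        (_ : FredholmTikhonov.IsBestApproxSolution a b k y xdag)
        (ρ₀ : ℝ) (_ : ρ₀ = ‖xdag‖ + σ / √(n : ℝ))
        (α : ℝ) (_ : 0 < α)
        (_ : c₁ * (σ / √(n : ℝ) / ρ₀) ≤ α ^ (1 / 2 + 1 / (4 * (m : ℝ))))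
        (_ : α ^ (1 / 2 + 1 / (4 * (m : ℝ))) ≤ c₂ * (σ / √(n : ℝ) / ρ₀))
        (x : Ω → FredholmTikhonov.L2 a b)
        (_ : ∀ ω, FredholmTikhonov.IsRegularizedSolution a b k s
          (FredholmTikhonov.sample a b s y + fun i => e i ω) α (x ω)),
        (∀ z : ℝ, 0 ≤ z →
          P.real {ω | √α * ρ₀ * z ≤ FredholmTikhonov.empNorm
            (FredholmTikhonov.sample a b s (FredholmTikhonov.integralOp a b k (x ω)) -
              FredholmTikhonov.sample a b s (FredholmTikhonov.integralOp a b k xdag))} ≤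
            2 * Real.exp (-C * z ^ 2)) ∧
        (∀ z : ℝ, 0 ≤ z →
          P.real {ω | ρ₀ * z ≤ ‖x ω‖} ≤ 2 * Real.exp (-C * z ^ 2)) ∧
        FredholmTikhonov.orliczNorm P FredholmTikhonov.psiTwo
          (fun ω => FredholmTikhonov.empNorm
            (FredholmTikhonov.sample a b s (FredholmTikhonov.integralOp a b k (x ω)) -
              FredholmTikhonov.sample a b s (FredholmTikhonov.integralOp a b k xdag))) ≤
          ENNReal.ofReal (C' * (√α * ρ₀)) ∧
        FredholmTikhonov.orliczNorm P FredholmTikhonov.psiTwo (fun ω => ‖x ω‖) ≤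
          ENNReal.ofReal (C' * ρ₀) := by
  obtain ⟨l, rfl⟩ : ∃ l, m = l + 1 := ⟨m - 1, by omega⟩
  obtain ⟨B, hB⟩ := exists_weakDeriv_bound hk hrange
  obtain ⟨C₀, hC₀, hcells⟩ := exists_number_of_cells l (c₂ := c₂)
    (E := (b - a) ^ (2 * l + 1) * B ^ 2)
    (mul_nonneg (pow_nonneg (sub_pos.2 hab).le _) (sq_nonneg B))
  set G : ℝ := 12 + 64 * C₀ / c₁ ^ 2 with hG
  have hG0 : 0 < G := by positivity
  refine ⟨1 / G, by positivity, √G, Real.sqrt_pos.2 hG0, ?_⟩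
  intro Ω _ P _ n hn s _ hs σ hσ e he y hy xdag hxdag ρ₀ hρ₀ α hα hα₁ hα₂ x hx
  have hn0 : (0 : ℝ) < n := by positivity
  have hν0 : 0 < σ / √(n : ℝ) := div_pos hσ (Real.sqrt_pos.2 hn0)
  have hρ0 : 0 < ρ₀ := by rw [hρ₀]; positivity
  have hxρ : ‖xdag‖ ≤ ρ₀ := by rw [hρ₀]; linarith
  have hνρ : σ / √(n : ℝ) / ρ₀ ≤ 1 := by
    rw [div_le_one hρ0, hρ₀]
    linarith [norm_nonneg xdag]
  obtain ⟨N, hN1, hN⟩ := hcells α hα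
    (hα₂.trans (mul_le_of_le_one_right (hc₁.le.trans hc₂) hνρ))
  obtain ⟨L, hL0, hLsum, hL⟩ := exists_leverage_integralOp hab hrange hB hs hN1 hα
  obtain ⟨A, hA⟩ := exists_sampling_linearMap hab hk hrange hs
  obtain ⟨r, M, hM, hdual⟩ := exists_matrix_of_pointwise_bound hn A hα L hL0
    (fun h i => by rw [hA]; exact hL h i)
  set β : ℝ := α ^ (-(1 / (2 * ((l + 1 : ℕ) : ℝ)))) with hβ
  have hMβ : ∑ j, ∑ i, M j i ^ 2 ≤ n * (C₀ * β) := by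
    refine hM.trans (hLsum.trans (mul_le_mul_of_nonneg_left (le_trans (le_of_eq ?_) hN) hn0.le))
    rw [div_pow]
    ring
  have hβα : σ ^ 2 / n * β ≤ α * ρ₀ ^ 2 / c₁ ^ 2 := by
    have h1 : (c₁ * (σ / √(n : ℝ))) ^ 2 ≤
        (α ^ (1 / 2 + 1 / (4 * ((l + 1 : ℕ) : ℝ))) * ρ₀) ^ 2 := by
      refine pow_le_pow_left₀ (by positivity) ?_ 2
      rw [← mul_div_assoc, div_le_iff₀ hρ0] at hα₁
      exact hα₁
    have h2 : (α ^ (1 / 2 + 1 / (4 * ((l + 1 : ℕ) : ℝ)))) ^ 2 * β = α := by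
      rw [hβ, ← Real.rpow_natCast, ← Real.rpow_mul hα.le, ← Real.rpow_add hα]
      conv_rhs => rw [← Real.rpow_one α]
      congr 1
      push_cast
      have : (l + 1 : ℝ) ≠ 0 := by positivity
      field_simp
      ring
    have hβ0 : 0 < β := Real.rpow_pos_of_pos hα _
    have h3 : c₁ ^ 2 * (σ ^ 2 / n) * β ≤ α * ρ₀ ^ 2 := by
      rw [mul_pow, mul_pow, div_pow, Real.sq_sqrt hn0.le] at h1
      calc _ ≤ (α ^ (1 / 2 + 1 / (4 * ((l + 1 : ℕ) : ℝ)))) ^ 2 * ρ₀ ^ 2 * β := by gcongr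
        _ = (α ^ (1 / 2 + 1 / (4 * ((l + 1 : ℕ) : ℝ)))) ^ 2 * β * ρ₀ ^ 2 := by ring
        _ = _ := by rw [h2]
    rw [le_div_iff₀ (by positivity)]
    linarith
  set V : Ω → ℝ := fun ω => ∑ j, (∑ i, M j i * e i ω) ^ 2 with hV
  have hV0 : ∀ ω, 0 ≤ V ω := fun ω => Finset.sum_nonneg fun j _ => sq_nonneg _
  have hVm : AEMeasurable V P := by
    have := fun i => (he.subgaussian i).aemeasurable
    fun_prop
  have hyd := integralOp_ae_eq_of_isBestApproxSolution (fun x => (hrange x).1) hy hxdag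
  have hyA : sample a b s y = A xdag := by
    have hspec := contRep_integralOp_spec hab hrange xdag
    rw [hA]
    ext i
    exact contRep_eqOn hab hspec.1 (hspec.2.trans hyd) (hs i)
  set U : Ω → ℝ := fun ω => 8 / (n : ℝ) ^ 2 * V ω + 3 * α * ‖xdag‖ ^ 2 with hU
  have hstab : ∀ ω, empNorm (A (x ω) - A xdag) ^ 2 + α * ‖x ω‖ ^ 2 ≤ U ω := fun ω => by
    refine tikhonov_stability hn A hα (fun i => e i ω) (fun h => ?_) (hV0 ω) (x ω) xdag ?_
    · exact hdual (fun i => e i ω) h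
    · have := hx ω xdag
      simp only [tikhonov, ← hA, hyA] at this
      exact this
  set T : ℝ := √G * (√α * ρ₀) with hT
  have hsα : 0 < √α := Real.sqrt_pos.2 hα
  have hsG : 0 < √G := Real.sqrt_pos.2 hG0
  have hT0 : 0 < T := by positivity
  have hT2 : T ^ 2 = G * (α * ρ₀ ^ 2) := by
    rw [hT, mul_pow, mul_pow, Real.sq_sqrt hG0.le, Real.sq_sqrt hα.le]
  have hαρ : 0 < α * ρ₀ ^ 2 := by positivity
  set γ : ℝ := 16 / ((n : ℝ) ^ 2 * T ^ 2) with hγ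
  have hγV : ∫⁻ ω, ENNReal.ofReal (Real.exp (γ * V ω)) ∂P ≤ 2 := by
    refine lintegral_exp_quadratic_le he.indep he.subgaussian M (by positivity) ?_
    rw [NNReal.coe_pow, Real.coe_toNNReal _ hσ.le]
    have h1 : 64 * C₀ / c₁ ^ 2 ≤ G := by rw [hG]; linarith
    calc γ * (σ ^ 2 * ∑ j, ∑ i, M j i ^ 2) ≤ γ * (σ ^ 2 * (n * (C₀ * β))) := by gcongr
      _ = 16 * C₀ * (σ ^ 2 / n * β) / T ^ 2 := by rw [hγ]; field_simp
      _ ≤ 16 * C₀ * (α * ρ₀ ^ 2 / c₁ ^ 2) / T ^ 2 := by gcongr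
      _ = 64 * C₀ / c₁ ^ 2 * (α * ρ₀ ^ 2) / (4 * T ^ 2) := by ring
      _ ≤ G * (α * ρ₀ ^ 2) / (4 * T ^ 2) := by gcongr
      _ = 1 / 4 := by rw [hT2]; field_simp
  have hUint : ∫⁻ ω, ENNReal.ofReal (Real.exp (U ω / T ^ 2)) ∂P ≤ 2 := by
    refine lintegral_exp_affine_le hV0 hT0 hγV (le_of_eq ?_) ?_
    · rw [hγ]; field_simp; norm_num
    · have h1 : 12 ≤ G := by
        rw [hG]
        have : 0 ≤ 64 * C₀ / c₁ ^ 2 := by positivity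
        linarith
      have h2 : ‖xdag‖ ^ 2 ≤ ρ₀ ^ 2 := pow_le_pow_left₀ (norm_nonneg _) hxρ 2
      calc 4 * (3 * α * ‖xdag‖ ^ 2) = 12 * (α * ‖xdag‖ ^ 2) := by ring
        _ ≤ G * (α * ρ₀ ^ 2) := by gcongr
        _ = T ^ 2 := hT2.symm
  have hUm : AEMeasurable U P := by fun_prop
  have hZ₁ : ∀ ω, empNorm (sample a b s (integralOp a b k (x ω)) -
      sample a b s (integralOp a b k xdag)) ^ 2 ≤ U ω := fun ω => by
    rw [← hA, ← hA]
    have := hstab ω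
    have : 0 ≤ α * ‖x ω‖ ^ 2 := by positivity
    linarith
  have hZ₂ : ∀ ω, ‖x ω‖ ^ 2 ≤ U ω / α := fun ω => by
    rw [le_div_iff₀ hα]
    have := hstab ω
    have := sq_nonneg (empNorm (A (x ω) - A xdag))
    linarith
  set T' : ℝ := √G * ρ₀ with hT'
  have hT'0 : 0 < T' := by positivity
  have hUint' : ∫⁻ ω, ENNReal.ofReal (Real.exp (U ω / α / T' ^ 2)) ∂P ≤ 2 := by
    have : α * T' ^ 2 = T ^ 2 := by
      rw [hT2, hT', mul_pow, Real.sq_sqrt hG0.le]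
      ring
    simpa only [div_div, this] using hUint
  refine ⟨fun z hz => ?_, fun z hz => ?_, orliczNorm_psiTwo_le hT0 hZ₁ hUint,
    orliczNorm_psiTwo_le hT'0 hZ₂ hUint'⟩
  · refine (measureReal_le_two_mul_exp hUm hT0 hZ₁ hUint (by positivity)).trans (le_of_eq ?_)
    have : √α * ρ₀ * z / T = z / √G := by rw [hT]; field_simp
    rw [this, div_pow, Real.sq_sqrt hG0.le]
    congr 2
    ring
  · refine (measureReal_le_two_mul_exp (hUm.div_const α) hT'0 hZ₂ hUint'
      (by positivity)).trans (le_of_eq ?_)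
    have : ρ₀ * z / T' = z / √G := by rw [hT']; field_simp
    rw [this, div_pow, Real.sq_sqrt hG0.le]
    congr 2
    ring
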